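/- **Conventions.** Let $\mathcal P=\{p_1=0,\dots,p_m=0\}$ with $p_i\in\mathbb R[x_1,\dots,x_n]$, and let $S\subseteq\mathbb R^n$ be its set of common real zeros, $I(S)$ the ideal of polynomials vanishing on $S$. For a polynomial $f$, $\|f\|_\infty$ is the largest absolute value of a coefficient of $f$. * $\mathcal P$ is a *system over the finite domain* $D=\{\rho_1,\dots,\rho_k\}\subset\mathbb Q$ (repetitions allowed) if each domain polynomial $D_k(x_j)=(x_j-\rho_1)\cdots(x_j-\rho_k)$, $1\le j\le n$, is among the $p_i$. * An *SoS proof* of "$r\ge 0$" from $\mathcal P$ of degree at most $e$ is an identity $r=\sum_{i=1}^t s_i^2+\sum_{i=1}^m h_ip_i$ with real polynomials $s_i,h_i$ such that $\deg s_i^2\le e$ and $\deg h_ip_i\le e$ for all $i$. Its coefficients are bounded by $B$ if $\|s_i\|_\infty\le B$ and $\|h_i\|_\infty\le B$ for all $i$. * A *PC derivation* of $g$ from $\mathcal P$ is a finite sequence of polynomials with rational coefficients ending in $g$, each of which is some $p_i$, or some $D_k(x_j)$, or $af+bf'$ with $f,f'$ earlier in the sequence and $a,b\in\mathbb R$, or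 $x_jf$ with $f$ earlier in the sequence. Its *size* is the total length of the binary encodings of its members (rationals encoded as reduced fractions), its *degree* their largest degree. * A *$2d$-truncated Gröbner basis* $\mathcal G_{2d}$ of $I(S)$ is the set of elements of degree at most $2d$ of a (finite) Gröbner basis of $I(S)$ for the graded lexicographic order. **Theorem.** For all $k,c\in\mathbb N$ there is $A\in\mathbb N$, and for every univariate polynomial $b$ with coefficients in $\mathbb N$ there is a bivariate polynomial $Q$ with coefficients in $\mathbb N$ (depending only on $k,c,b$), such that the following holds for all $n\ge 2$ and $d\ge 1$. Let $\mathcal P$ be a polynomial system in $n$ variables over a finite domain of $k$ rational values, each with binary encoding of length at most $b(n^d)$, and let $\mathcal G_{2d}$ be a $2d$-truncated Gröbner basis of $I(S)$ such that every $g\in\mathcal G_{2d}$ satisfies $\|g\|_\infty\le 2^{b(n^d)}$ and has a PC derivation from $\mathcal P$ of size at most $b(n^d)$ and degree at most $c\,d$. Then: 1. For every real polynomial $r$ with $\|r\|_\infty\le 2^{b(n^d)}$ such that "$r\ge 0$" has an SoS proof from $\mathcal P$ of degree at most $2d$, and for every $\varepsilon>0$, "$r+\varepsilon\ge 0$" has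 an SoS proof from $\mathcal P$ of degree at most $A\,d$ with coefficients bounded by $2^{Q(n^d,\ell)}$, where $\ell=\max(0,\lceil\log_2(1/\varepsilon)\rceil)$. 2. If $S=\emptyset$, then "$-1\ge 0$" has an SoS proof from $\mathcal P$ of degree at most $A\,d$ with coefficients bounded by $2^{Q(n^d,0)}$. -/

import Mathlib

noncomputable section

namespace PCCriterion

open MvPolynomial

/-- The ring `ℝ[x_1, …, x_n]`. -/
abbrev Poly (n : ℕ) : Type := MvPolynomial (Fin n) ℝ

/-- All coefficients of `f` are at most `B` in absolute value, i.e. `‖f‖_∞ ≤ B`. -/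
def CoeffBound {n : ℕ} (f : Poly n) (B : ℝ) : Prop :=
  ∀ a : Fin n →₀ ℕ, |coeff a f| ≤ B

/-- The domain polynomial `(x_j - ρ_1) ⋯ (x_j - ρ_k)`. -/
def domainPoly {n k : ℕ} (ρ : Fin k → ℚ) (j : Fin n) : Poly n :=
  ∏ i, (X j - C (ρ i : ℝ))

/-- `{p_1 = 0, …, p_m = 0}` is a polynomial system over the domain `{ρ_1, …, ρ_k}`:
the domain polynomial of every variable is among the `p_i`. -/
def IsSystemOver {n m k : ℕ} (ρ : Fin k → ℚ) (p : Fin m → Poly n) : Prop :=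
  ∀ j : Fin n, domainPoly ρ j ∈ Set.range p

/-- The set of common real zeros of the `p_i`. -/
def variety {n m : ℕ} (p : Fin m → Poly n) : Set (Fin n → ℝ) :=
  {x | ∀ i, eval x (p i) = 0}

/-- `r = ∑ s_i ^ 2 + ∑ h_i p_i` is a sum-of-squares proof of `r ≥ 0` from
`{p_1 = 0, …, p_m = 0}` of degree at most `D`. -/
structure IsSoSProof {n m t : ℕ} (p : Fin m → Poly n) (r : Poly n) (D : ℕ)
    (s : Fin t → Poly n) (h : Fin m → Poly n) : Prop where
  identity : r = ∑ i, s i ^ 2 + ∑ i, h i * p i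
  degree_sq : ∀ i, (s i ^ 2).totalDegree ≤ D
  degree_mul : ∀ i, (h i * p i).totalDegree ≤ D

/-- `r ≥ 0` has a sum-of-squares proof of degree at most `D`. -/
def HasSoSProof {n m : ℕ} (p : Fin m → Poly n) (r : Poly n) (D : ℕ) : Prop :=
  ∃ (t : ℕ) (s : Fin t → Poly n) (h : Fin m → Poly n), IsSoSProof p r D s h

/-- `r ≥ 0` has a sum-of-squares proof of degree at most `D` in which all coefficients of the
polynomials `s_i` and `h_i` are at most `B` in absolute value. -/
def HasBoundedSoSProof {n m : ℕ} (p : Fin m → Poly n) (r : Poly n) (D : ℕ) (B : ℝ) : Prop :=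
  ∃ (t : ℕ) (s : Fin t → Poly n) (h : Fin m → Poly n),
    IsSoSProof p r D s h ∧ (∀ i, CoeffBound (s i) B) ∧ (∀ i, CoeffBound (h i) B)

/-- `G` is a Gröbner basis of the ideal `I` for the graded lexicographic order with
`x_1 > ⋯ > x_n`: it is a finite subset of `I`, and the leading monomial of every nonzero element
of `I` is divisible by the leading monomial of a nonzero element of `G`. -/
def IsGroebnerBasis {n : ℕ} (I : Ideal (Poly n)) (G : Finset (Poly n)) : Prop :=
  (∀ g ∈ G, g ∈ I) ∧
    ∀ f ∈ I, f ≠ 0 → ∃ g ∈ G, g ≠ 0 ∧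
      MonomialOrder.degLex.degree g ≤ MonomialOrder.degLex.degree f

/-- Length of the binary encoding of a reduced fraction: sign, numerator, denominator. -/
def ratBits (q : ℚ) : ℕ := 1 + q.num.natAbs.size + q.den.size

/-- Length of the binary encoding of a monomial, as the list of the variables that occur in it
(given by their indices) with their exponents. -/
def monomialBits {n : ℕ} (a : Fin n →₀ ℕ) : ℕ :=
  ∑ j ∈ a.support, ((j.val + 1).size + (a j).size)

/-- Length of the binary encoding of a rational polynomial, as the list of its terms. -/
def polyBits {n : ℕ} (f : MvPolynomial (Fin n) ℚ) : ℕ :=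
  1 + ∑ a ∈ f.support, (ratBits (coeff a f) + monomialBits a)

/-- A rational polynomial, seen as a real one. -/
def toReal {n : ℕ} (f : MvPolynomial (Fin n) ℚ) : Poly n :=
  map (algebraMap ℚ ℝ) f

/-- The inference rules of the polynomial calculus: `PCStep ρ p prev f` says that `f = 0` is
obtained by one application of a rule from the equations `g = 0` with `g ∈ prev`. -/
inductive PCStep {n m k : ℕ} (ρ : Fin k → ℚ) (p : Fin m → Poly n) (prev : Set (Poly n)) :
    Poly n → Prop
  | member (i : Fin m) : PCStep ρ p prev (p i)
  | domain (j : Fin n) : PCStep ρ p prev (domainPoly ρ j)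
  | linear (f g : Poly n) (hf : f ∈ prev) (hg : g ∈ prev) (a b : ℝ) :
      PCStep ρ p prev (C a * f + C b * g)
  | mul (j : Fin n) (f : Poly n) (hf : f ∈ prev) : PCStep ρ p prev (X j * f)

/-- `f = 0` has a polynomial calculus derivation of size at most `size` and degree at most `deg`:
a nonempty sequence of polynomials ending in `f`, each obtained by a rule from earlier ones. The
size is the total length of the binary encodings of the polynomials of the sequence (which
therefore have rational coefficients), the degree is their maximal degree. -/
def HasPCDerivation {n m k : ℕ} (ρ : Fin k → ℚ) (p : Fin m → Poly n) (f : Poly n)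
    (size deg : ℕ) : Prop :=
  ∃ (L : ℕ) (q : Fin (L + 1) → MvPolynomial (Fin n) ℚ),
    (∀ i, PCStep ρ p {g | ∃ j < i, g = toReal (q j)} (toReal (q i))) ∧
    toReal (q (Fin.last L)) = f ∧
    ∑ i, polyBits (q i) ≤ size ∧
    ∀ i, (q i).totalDegree ≤ deg

end PCCriterion

end

noncomputable section

namespace PCCriterion

open MvPolynomial

/-- The sum of the absolute values of the coefficients of a polynomial. -/
def l1 {n : ℕ} (f : Poly n) : ℝ := ∑ a ∈ f.support, |coeff a f|

section L1

variable {n : ℕ}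

lemma l1_nonneg (f : Poly n) : 0 ≤ l1 f := Finset.sum_nonneg fun _ _ => abs_nonneg _

lemma l1_eq_sum_of_subset {f : Poly n} {s : Finset (Fin n →₀ ℕ)} (h : f.support ⊆ s) :
    l1 f = ∑ a ∈ s, |coeff a f| := by
  refine Finset.sum_subset h fun a _ ha => ?_
  rw [notMem_support_iff.mp ha, abs_zero]

lemma abs_coeff_le_l1 (f : Poly n) (a : Fin n →₀ ℕ) : |coeff a f| ≤ l1 f := by
  by_cases ha : a ∈ f.support
  · exact Finset.single_le_sum (f := fun a => |coeff a f|) (fun _ _ => abs_nonneg _) ha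
  · rw [notMem_support_iff.mp ha, abs_zero]
    exact l1_nonneg f

@[simp] lemma l1_zero : l1 (0 : Poly n) = 0 := by simp [l1]

@[simp] lemma l1_neg (f : Poly n) : l1 (-f) = l1 f := by
  simp [l1, support_neg, coeff_neg]

lemma l1_add_le (f g : Poly n) : l1 (f + g) ≤ l1 f + l1 g := by
  classical
  rw [l1_eq_sum_of_subset (support_add (p := f) (q := g)),
    l1_eq_sum_of_subset (f := f) (Finset.subset_union_left (s₂ := g.support)),
    l1_eq_sum_of_subset (f := g) (Finset.subset_union_right (s₁ := f.support)),
    ← Finset.sum_add_distrib]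
  exact Finset.sum_le_sum fun a _ => by rw [coeff_add]; exact abs_add_le _ _

lemma l1_sub_le (f g : Poly n) : l1 (f - g) ≤ l1 f + l1 g := by
  rw [sub_eq_add_neg, ← l1_neg g]
  exact l1_add_le _ _

lemma l1_sum_le {ι : Type*} (s : Finset ι) (f : ι → Poly n) :
    l1 (∑ i ∈ s, f i) ≤ ∑ i ∈ s, l1 (f i) := by
  classical
  induction s using Finset.induction_on with
  | empty => simp
  | insert i s hi ih =>
    rw [Finset.sum_insert hi, Finset.sum_insert hi]
    exact (l1_add_le _ _).trans (by gcongr)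

lemma l1_monomial (a : Fin n →₀ ℕ) (c : ℝ) : l1 (monomial a c) = |c| := by
  rw [l1_eq_sum_of_subset (s := {a}) support_monomial_subset]
  simp

lemma l1_C (c : ℝ) : l1 (C c : Poly n) = |c| := l1_monomial 0 c

lemma l1_X (j : Fin n) : l1 (X j : Poly n) = 1 := by
  rw [X, l1_monomial, abs_one]

lemma l1_monomial_mul_le (a : Fin n →₀ ℕ) (c : ℝ) (f : Poly n) :
    l1 (monomial a c * f) ≤ |c| * l1 f := by
  conv_lhs => rw [f.as_sum, Finset.mul_sum]
  refine (l1_sum_le _ _).trans ?_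
  rw [l1, Finset.mul_sum]
  refine Finset.sum_le_sum fun b _ => ?_
  rw [monomial_mul, l1_monomial, abs_mul]

lemma l1_mul_le (f g : Poly n) : l1 (f * g) ≤ l1 f * l1 g := by
  conv_lhs => rw [f.as_sum, Finset.sum_mul]
  refine (l1_sum_le _ _).trans ?_
  rw [l1, Finset.sum_mul]
  exact Finset.sum_le_sum fun b _ => l1_monomial_mul_le _ _ _

lemma l1_pow_two_le (f : Poly n) : l1 (f ^ 2) ≤ l1 f ^ 2 := by
  rw [pow_two, pow_two]
  exact l1_mul_le f f

lemma l1_C_mul_le (c : ℝ) (f : Poly n) : l1 (C c * f) ≤ |c| * l1 f := l1_monomial_mul_le 0 c f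

lemma l1_prod_le {ι : Type*} (s : Finset ι) (f : ι → Poly n) :
    l1 (∏ i ∈ s, f i) ≤ ∏ i ∈ s, l1 (f i) := by
  classical
  induction s using Finset.induction_on with
  | empty => simpa using (l1_C (n := n) 1).le
  | insert i s hi ih =>
    rw [Finset.prod_insert hi, Finset.prod_insert hi]
    exact (l1_mul_le _ _).trans (mul_le_mul_of_nonneg_left ih (l1_nonneg _))

lemma l1_le_card_mul {f : Poly n} {s : Finset (Fin n →₀ ℕ)} (h : f.support ⊆ s) {B : ℝ}
    (hB : CoeffBound f B) : l1 f ≤ s.card * B := by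
  rw [l1_eq_sum_of_subset h, ← nsmul_eq_mul]
  exact Finset.sum_le_card_nsmul _ _ _ fun a _ => hB a

lemma abs_eval_le {f : Poly n} {D : ℕ} (hD : f.totalDegree ≤ D) {x : Fin n → ℝ} {R : ℝ}
    (hR : 1 ≤ R) (hx : ∀ j, |x j| ≤ R) : |eval x f| ≤ l1 f * R ^ D := by
  rw [eval_eq, l1, Finset.sum_mul]
  refine (Finset.abs_sum_le_sum_abs _ _).trans (Finset.sum_le_sum fun a ha => ?_)
  rw [abs_mul, Finset.abs_prod]
  refine mul_le_mul_of_nonneg_left ?_ (abs_nonneg _)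
  calc ∏ j ∈ a.support, |x j ^ a j| ≤ ∏ j ∈ a.support, R ^ a j := by
        refine Finset.prod_le_prod (fun _ _ => abs_nonneg _) fun j _ => ?_
        rw [abs_pow]
        exact pow_le_pow_left₀ (abs_nonneg _) (hx j) _
    _ = R ^ (a.sum fun _ e => e) := by rw [Finset.prod_pow_eq_pow_sum]; rfl
    _ ≤ R ^ D := pow_le_pow_right₀ hR ((le_totalDegree ha).trans hD)

end L1

/-- `f` is a sum of squares plus `∑ h_i p_i`, with all terms of degree at most `e` and the
coefficients of every `h_i` summing up to at most `B` in absolute value. -/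
def Cert {n m : ℕ} (p : Fin m → Poly n) (e : ℕ) (B : ℝ) (f : Poly n) : Prop :=
  ∃ (t : ℕ) (s : Fin t → Poly n) (h : Fin m → Poly n), IsSoSProof p f e s h ∧ ∀ i, l1 (h i) ≤ B

namespace Cert

variable {n m e : ℕ} {p : Fin m → Poly n} {B B' : ℝ} {f g : Poly n}

lemma mono (hf : Cert p e B f) (h : B ≤ B') : Cert p e B' f := by
  obtain ⟨t, s, q, hq, hB⟩ := hf
  exact ⟨t, s, q, hq, fun i => (hB i).trans h⟩

lemma add (hf : Cert p e B f) (hg : Cert p e B' g) : Cert p e (B + B') (f + g) := by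
  obtain ⟨t, s, q, hq, hB⟩ := hf
  obtain ⟨t', s', q', hq', hB'⟩ := hg
  refine ⟨t + t', Fin.append s s', fun i => q i + q' i, ⟨?_, fun i => ?_, fun i => ?_⟩,
    fun i => (l1_add_le _ _).trans (add_le_add (hB i) (hB' i))⟩
  · rw [hq.identity, hq'.identity, Fin.sum_univ_add]
    simp only [Fin.append_left, Fin.append_right, add_mul, Finset.sum_add_distrib]
    ring
  · refine Fin.addCases (fun i => ?_) (fun i => ?_) i
    · rw [Fin.append_left]; exact hq.degree_sq i
    · rw [Fin.append_right]; exact hq'.degree_sq i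
  · rw [add_mul]
    exact (totalDegree_add _ _).trans (max_le (hq.degree_mul i) (hq'.degree_mul i))

lemma zero : Cert p e 0 0 :=
  ⟨0, Fin.elim0, fun _ => 0, ⟨by simp, fun i => i.elim0, fun i => by simp⟩, fun i => by simp⟩

lemma sq (h : 2 * f.totalDegree ≤ e) : Cert p e 0 (f ^ 2) :=
  ⟨1, fun _ => f, fun _ => 0, ⟨by simp, fun _ => (totalDegree_pow _ _).trans h, fun i => by simp⟩,
    fun i => by simp⟩

lemma sum_sq {ι : Type*} (s : Finset ι) (f : ι → Poly n) (h : ∀ i ∈ s, 2 * (f i).totalDegree ≤ e) :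
    Cert p e 0 (∑ i ∈ s, f i ^ 2) := by
  classical
  induction s using Finset.induction_on with
  | empty => simpa using zero
  | insert i s hi ih =>
    rw [Finset.sum_insert hi]
    refine ((sq (h i (Finset.mem_insert_self _ _))).add
      (ih fun i hi => h i (Finset.mem_insert_of_mem hi))).mono (by simp)

lemma const {c : ℝ} (hc : 0 ≤ c) : Cert p e 0 (C c) := by
  rw [← Real.sq_sqrt hc, C_pow]
  exact sq (by simp)

lemma eq_mul (i : Fin m) (h : (f * p i).totalDegree ≤ e) (hB : l1 f ≤ B) :
    Cert p e B (f * p i) := by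
  classical
  refine ⟨0, Fin.elim0, Pi.single i f, ⟨?_, fun i => i.elim0, fun j => ?_⟩, fun j => ?_⟩
  · rw [Finset.sum_eq_single i (fun j _ hj => by rw [Pi.single_eq_of_ne hj, zero_mul])
      (fun h => (h (Finset.mem_univ _)).elim)]
    simp
  · by_cases hj : j = i
    · subst hj; rwa [Pi.single_eq_same]
    · rw [Pi.single_eq_of_ne hj, zero_mul, totalDegree_zero]; exact Nat.zero_le _
  · by_cases hj : j = i
    · subst hj; rwa [Pi.single_eq_same]
    · rw [Pi.single_eq_of_ne hj, l1_zero]; exact (l1_nonneg _).trans hB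

lemma totalDegree_C_mul_le (c : ℝ) (f : Poly n) : (C c * f).totalDegree ≤ f.totalDegree := by
  refine (totalDegree_mul _ _).trans ?_
  rw [totalDegree_C, zero_add]

lemma smul {c : ℝ} (hc : 0 ≤ c) (hf : Cert p e B f) : Cert p e (c * B) (C c * f) := by
  obtain ⟨t, s, q, hq, hB⟩ := hf
  refine ⟨t, fun i => C (√c) * s i, fun i => C c * q i, ⟨?_, fun i => ?_, fun i => ?_⟩,
    fun i => ?_⟩
  · have hcc : (C c : Poly n) = C (√c) ^ 2 := by rw [← C_pow, Real.sq_sqrt hc]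
    rw [hq.identity, mul_add, Finset.mul_sum, Finset.mul_sum]
    congr 1
    · exact Finset.sum_congr rfl fun i _ => by rw [mul_pow, hcc]
    · exact Finset.sum_congr rfl fun i _ => by rw [mul_assoc]
  · rw [mul_pow, ← C_pow]
    exact (totalDegree_C_mul_le _ _).trans (hq.degree_sq i)
  · rw [mul_assoc]
    exact (totalDegree_C_mul_le _ _).trans (hq.degree_mul i)
  · refine (l1_C_mul_le _ _).trans ?_
    rw [abs_of_nonneg hc]
    exact mul_le_mul_of_nonneg_left (hB i) hc

/-- Splitting every square into many equal ones makes the coefficients of the squared polynomials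
as small as desired. -/
lemma hasBoundedSoSProof (hf : Cert p e B f) (hB : B ≤ B') (hB' : 0 < B') :
    HasBoundedSoSProof p f e B' := by
  obtain ⟨t, s, q, hq, hqB⟩ := hf
  obtain ⟨N, hN⟩ := exists_nat_gt ((∑ i, l1 (s i)) / B')
  have hNpos : (0 : ℝ) < N :=
    lt_of_le_of_lt (div_nonneg (Finset.sum_nonneg fun i _ => l1_nonneg _) hB'.le) hN
  let φ : Fin (t * N ^ 2) ≃ Fin t × Fin (N ^ 2) := finProdFinEquiv.symm
  refine ⟨t * N ^ 2, fun i => C (N : ℝ)⁻¹ * s (φ i).1, q, ⟨?_, fun i => ?_, hq.degree_mul⟩,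
    fun i a => ?_, fun i a => ?_⟩
  · rw [hq.identity, φ.sum_comp (fun x => (C (N : ℝ)⁻¹ * s x.1) ^ 2), Fintype.sum_prod_type]
    congr 1
    refine Finset.sum_congr rfl fun i _ => ?_
    change s i ^ 2 = ∑ _y : Fin (N ^ 2), (C (N : ℝ)⁻¹ * s i) ^ 2
    rw [Finset.sum_const, Finset.card_univ, Fintype.card_fin, nsmul_eq_mul, mul_pow, ← C_pow,
      ← mul_assoc, ← map_natCast (C : ℝ →+* Poly n), ← C_mul]
    rw [show ((N ^ 2 : ℕ) : ℝ) * (N : ℝ)⁻¹ ^ 2 = 1 by push_cast; field_simp, C_1, one_mul]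
  · rw [mul_pow, ← C_pow]
    exact (totalDegree_C_mul_le _ _).trans (hq.degree_sq _)
  · rw [coeff_C_mul, abs_mul, abs_of_pos (inv_pos.mpr hNpos), inv_mul_le_iff₀ hNpos]
    refine (abs_coeff_le_l1 _ _).trans ?_
    refine (Finset.single_le_sum (f := fun i => l1 (s i)) (fun _ _ => l1_nonneg _)
      (Finset.mem_univ (φ i).1)).trans ?_
    exact ((div_lt_iff₀ hB').mp hN).le
  · exact (abs_coeff_le_l1 _ _).trans ((hqB i).trans hB)

end Cert

/-- A strictly positive univariate real polynomial is a sum of two squares. -/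
theorem exists_eq_sq_add_sq_of_pos (P : Polynomial ℝ) (hP : ∀ x, 0 < P.eval x) :
    ∃ u v : Polynomial ℝ, P = u ^ 2 + v ^ 2 ∧ 2 * u.natDegree ≤ P.natDegree ∧
      2 * v.natDegree ≤ P.natDegree := by
  induction hd : P.natDegree using Nat.strong_induction_on generalizing P with
  | _ N ih =>
  rcases Nat.eq_zero_or_pos N with rfl | hN
  · obtain ⟨c, rfl⟩ := Polynomial.natDegree_eq_zero.mp hd
    have hc : 0 < c := by simpa using hP 0
    refine ⟨Polynomial.C (√c), 0, ?_, by simp, by simp⟩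
    rw [← Polynomial.C_pow, Real.sq_sqrt hc.le]; simp
  · obtain ⟨z, hz⟩ := Complex.exists_root (f := P.map (algebraMap ℝ ℂ)) (by
      rw [Polynomial.degree_map]
      exact Polynomial.natDegree_pos_iff_degree_pos.mp (hd ▸ hN))
    have hz0 : Polynomial.aeval z P = 0 := by
      rwa [Polynomial.IsRoot, Polynomial.eval_map_algebraMap] at hz
    have him : z.im ≠ 0 := by
      intro h
      have hzr : z = (z.re : ℂ) := Complex.ext (by simp) (by simp [h])
      rw [hzr, ← Complex.coe_algebraMap, Polynomial.aeval_algebraMap_apply] at hz0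
      have : P.eval z.re = 0 := by simpa using hz0
      exact (hP z.re).ne' this
    obtain ⟨Q, hQ⟩ := P.quadratic_dvd_of_aeval_eq_zero_im_ne_zero hz0 him
    have hfac : (Polynomial.X ^ 2 - Polynomial.C (2 * z.re) * Polynomial.X +
        Polynomial.C (‖z‖ ^ 2) : Polynomial ℝ) =
        (Polynomial.X - Polynomial.C z.re) ^ 2 + Polynomial.C z.im ^ 2 := by
      have : ‖z‖ ^ 2 = z.re ^ 2 + z.im ^ 2 := by
        rw [Complex.sq_norm, Complex.normSq_apply]; ring
      rw [this]
      simp only [map_add, map_mul, map_pow, map_ofNat]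
      ring
    have hP0 : P ≠ 0 := by rintro rfl; simpa using hP 0
    have hQ0 : Q ≠ 0 := by rintro rfl; exact hP0 (by simpa using hQ)
    have hdeg : P.natDegree = 2 + Q.natDegree := by
      rw [hQ, Polynomial.natDegree_mul _ hQ0]
      · congr 1
        compute_degree!
      · intro h
        exact hP0 (by rw [hQ, h, zero_mul])
    rw [hfac] at hQ
    obtain ⟨u, v, huv, hu, hv⟩ := ih Q.natDegree (by omega) Q (fun x => by
      have := hP x
      rw [hQ] at this
      simp only [Polynomial.eval_mul, Polynomial.eval_add, Polynomial.eval_pow,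
        Polynomial.eval_sub, Polynomial.eval_X, Polynomial.eval_C] at this
      exact pos_of_mul_pos_right this (by positivity)) rfl
    have h1 : (Polynomial.X - Polynomial.C z.re).natDegree = 1 := Polynomial.natDegree_X_sub_C _
    have h2 : (Polynomial.C z.im : Polynomial ℝ).natDegree = 0 := Polynomial.natDegree_C _
    refine ⟨(Polynomial.X - Polynomial.C z.re) * u - Polynomial.C z.im * v,
      (Polynomial.X - Polynomial.C z.re) * v + Polynomial.C z.im * u, ?_, ?_, ?_⟩
    · rw [hQ, huv]; ring
    · have a1 := Polynomial.natDegree_sub_le ((Polynomial.X - Polynomial.C z.re) * u)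
        (Polynomial.C z.im * v)
      have a2 := Polynomial.natDegree_mul_le (p := Polynomial.X - Polynomial.C z.re) (q := u)
      have a3 := Polynomial.natDegree_mul_le (p := Polynomial.C z.im) (q := v)
      omega
    · have a1 := Polynomial.natDegree_add_le ((Polynomial.X - Polynomial.C z.re) * v)
        (Polynomial.C z.im * u)
      have a2 := Polynomial.natDegree_mul_le (p := Polynomial.X - Polynomial.C z.re) (q := v)
      have a3 := Polynomial.natDegree_mul_le (p := Polynomial.C z.im) (q := u)
      omega

lemma totalDegree_aeval_X_le {n : ℕ} (j : Fin n) (u : Polynomial ℝ) :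
    (Polynomial.aeval (X j : Poly n) u).totalDegree ≤ u.natDegree := by
  rw [Polynomial.aeval_eq_sum_range]
  refine totalDegree_finsetSum_le fun i hi => ?_
  rw [smul_eq_C_mul]
  refine (Cert.totalDegree_C_mul_le _ _).trans ((totalDegree_pow _ _).trans ?_)
  rw [totalDegree_X, mul_one]
  exact Nat.lt_succ_iff.mp (Finset.mem_range.mp hi)

lemma totalDegree_domainPoly_le {n k : ℕ} (ρ : Fin k → ℚ) (j : Fin n) :
    (domainPoly ρ j).totalDegree ≤ k := by
  refine (totalDegree_finsetProd _ _).trans ?_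
  refine (Finset.sum_le_card_nsmul _ _ 1 fun i _ => ?_).trans (by simp)
  refine (totalDegree_sub _ _).trans ?_
  simp

lemma l1_domainPoly_le {n k : ℕ} (ρ : Fin k → ℚ) (j : Fin n) {R : ℝ}
    (hR : ∀ i, |(ρ i : ℝ)| + 1 ≤ R) : l1 (domainPoly ρ j) ≤ R ^ k := by
  refine (l1_prod_le _ _).trans ?_
  refine (Finset.prod_le_prod (fun _ _ => l1_nonneg _) (g := fun _ => R) fun i _ => ?_).trans
    (by simp)
  refine (l1_sub_le _ _).trans ?_
  rw [l1_X, l1_C, add_comm]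
  exact hR i

/-- Every variable is bounded on the domain, with a sum-of-squares certificate modulo the domain
polynomial. -/
lemma exists_domain_certificate {n k : ℕ} (ρ : Fin k → ℚ) (j : Fin n) {R : ℝ} (hR1 : 1 ≤ R)
    (hR : ∀ i, |(ρ i : ℝ)| + 1 ≤ R) :
    ∃ u v : Poly n, C (R ^ 2) - X j ^ 2 + X j ^ 2 * domainPoly ρ j ^ 2 = u ^ 2 + v ^ 2 ∧
      u.totalDegree ≤ k + 1 ∧ v.totalDegree ≤ k + 1 := by
  let D : Polynomial ℝ := ∏ i, (Polynomial.X - Polynomial.C (ρ i : ℝ))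
  let P : Polynomial ℝ := Polynomial.C (R ^ 2) - Polynomial.X ^ 2 + Polynomial.X ^ 2 * D ^ 2
  have hD : D.natDegree ≤ k := by
    refine (Polynomial.natDegree_prod_le _ _).trans ?_
    simp
  have hPd : P.natDegree ≤ 2 * (k + 1) := by
    have h1 : (Polynomial.X ^ 2 * D ^ 2).natDegree ≤ 2 * (k + 1) := by
      refine Polynomial.natDegree_mul_le.trans ?_
      have := Polynomial.natDegree_pow_le (p := D) (n := 2)
      rw [Polynomial.natDegree_X_pow]
      omega
    refine (Polynomial.natDegree_add_le _ _).trans (max_le ?_ h1)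
    refine (Polynomial.natDegree_sub_le _ _).trans (max_le ?_ ?_)
    · rw [Polynomial.natDegree_C]; omega
    · rw [Polynomial.natDegree_X_pow]; omega
  have hpos : ∀ x, 0 < P.eval x := by
    intro x
    have he : P.eval x = R ^ 2 - x ^ 2 + x ^ 2 * (∏ i, (x - (ρ i : ℝ))) ^ 2 := by
      simp [P, D, Polynomial.eval_prod]
    rw [he]
    by_cases hx : |x| < R
    · have : x ^ 2 < R ^ 2 := sq_lt_sq' (abs_lt.mp hx).1 (abs_lt.mp hx).2
      nlinarith [mul_nonneg (sq_nonneg x) (sq_nonneg (∏ i, (x - (ρ i : ℝ))))]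
    · push Not at hx
      have h1 : 1 ≤ |∏ i, (x - (ρ i : ℝ))| := by
        rw [Finset.abs_prod]
        rw [← Finset.prod_const_one (s := (Finset.univ : Finset (Fin k)))]
        refine Finset.prod_le_prod (fun _ _ => zero_le_one) fun i _ => ?_
        have := abs_sub_abs_le_abs_sub x (ρ i : ℝ)
        linarith [hR i]
      have h2 : 1 ≤ (∏ i, (x - (ρ i : ℝ))) ^ 2 := by
        rw [← sq_abs]; exact one_le_pow₀ h1
      nlinarith [mul_le_mul_of_nonneg_left h2 (sq_nonneg x)]
  obtain ⟨u, v, huv, hu, hv⟩ := exists_eq_sq_add_sq_of_pos P hpos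
  refine ⟨Polynomial.aeval (X j) u, Polynomial.aeval (X j) v, ?_,
    (totalDegree_aeval_X_le _ _).trans (by omega), (totalDegree_aeval_X_le _ _).trans (by omega)⟩
  have := congrArg (Polynomial.aeval (X j : Poly n)) huv
  simpa [P, D, domainPoly, map_prod, algebraMap_eq] using this

section System

variable {n m k : ℕ} {ρ : Fin k → ℚ} {p : Fin m → Poly n} {e : ℕ} {B R : ℝ}

lemma Cert.sub_sq_X_mul (hp : IsSystemOver ρ p) (hR1 : 1 ≤ R) (hR : ∀ i, |(ρ i : ℝ)| + 1 ≤ R)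
    {F f : Poly n} (hf : Cert p e B (F - f ^ 2)) (he : 2 * f.totalDegree + 2 * (k + 1) ≤ e)
    (j : Fin n) : Cert p e (R ^ 2 * B + R ^ k * l1 f ^ 2) (C (R ^ 2) * F - (X j * f) ^ 2) := by
  obtain ⟨u, v, huv, hu, hv⟩ := exists_domain_certificate (n := n) ρ j hR1 hR
  obtain ⟨i, hi⟩ := hp j
  have hD := totalDegree_domainPoly_le ρ j
  have h1 : Cert p e 0 ((u * f) ^ 2) := Cert.sq (by
    have := totalDegree_mul u f; omega)
  have h2 : Cert p e 0 ((v * f) ^ 2) := Cert.sq (by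
    have := totalDegree_mul v f; omega)
  have hl : l1 (-(domainPoly ρ j * (X j * f) ^ 2)) ≤ R ^ k * l1 f ^ 2 := by
    rw [l1_neg]
    refine (l1_mul_le _ _).trans (mul_le_mul (l1_domainPoly_le ρ j hR) ?_ (l1_nonneg _)
      (by positivity))
    refine (l1_pow_two_le _).trans (pow_le_pow_left₀ (l1_nonneg _) ?_ 2)
    refine (l1_mul_le _ _).trans ?_
    rw [l1_X, one_mul]
  have h3 : Cert p e (R ^ k * l1 f ^ 2) (-(domainPoly ρ j * (X j * f) ^ 2) * p i) := by
    refine Cert.eq_mul i ?_ hl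
    rw [hi, neg_mul, totalDegree_neg]
    have a1 := totalDegree_mul (domainPoly ρ j * (X j * f) ^ 2) (domainPoly ρ j)
    have a2 := totalDegree_mul (domainPoly ρ j) ((X j * f) ^ 2)
    have a3 := totalDegree_pow (X j * f) 2
    have a4 := totalDegree_mul (X j) f
    have a5 := totalDegree_X (R := ℝ) j
    omega
  have h4 := Cert.smul (sq_nonneg R) hf
  have := (h1.add h2).add (h4.add h3)
  rw [zero_add, zero_add, hi] at this
  convert this using 1
  rw [mul_pow u, mul_pow v, ← add_assoc, ← add_mul, ← huv]
  ring

lemma Cert.const_sub_monomial_sq (hp : IsSystemOver ρ p) (hR1 : 1 ≤ R)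
    (hR : ∀ i, |(ρ i : ℝ)| + 1 ≤ R) {D : ℕ} (he : 2 * D + 2 * (k + 1) ≤ e) (a : Fin n →₀ ℕ)
    (ha : a.degree ≤ D) :
    Cert p e ((R ^ 2 + R ^ k) ^ a.degree) (C ((R ^ 2) ^ a.degree) - monomial a 1 ^ 2) := by
  induction hN : a.degree generalizing a with
  | zero =>
    have : a = 0 := (Finsupp.degree_eq_zero_iff a).mp hN
    subst this
    have h0 : (monomial (0 : Fin n →₀ ℕ) (1 : ℝ)) = 1 := rfl
    rw [h0]
    simpa using Cert.zero.mono zero_le_one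
  | succ N ih =>
    have ha0 : a ≠ 0 := by rintro rfl; simp at hN
    obtain ⟨j, hj⟩ := Finsupp.support_nonempty_iff.mpr ha0
    have hle : Finsupp.single j 1 ≤ a := by
      rw [Finsupp.single_le_iff]
      exact Nat.one_le_iff_ne_zero.mpr (Finsupp.mem_support_iff.mp hj)
    obtain ⟨b, rfl⟩ := exists_add_of_le hle
    have hb : b.degree = N := by
      rw [map_add, Finsupp.degree_single] at hN; omega
    have hdeg : (monomial b (1 : ℝ)).totalDegree ≤ N := by
      rw [totalDegree_monomial _ one_ne_zero, ← hb]; exact le_rfl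
    have := Cert.sub_sq_X_mul hp hR1 hR (ih b (by omega) hb) (by omega) j
    rw [l1_monomial, abs_one, one_pow, mul_one, ← C_mul, ← pow_succ', X, monomial_mul, one_mul]
      at this
    refine this.mono ?_
    have h1 : 1 ≤ (R ^ 2 + R ^ k) ^ N :=
      one_le_pow₀ (by nlinarith [one_le_pow₀ hR1 (n := 2), one_le_pow₀ hR1 (n := k)])
    have h2 : 0 ≤ R ^ k := by positivity
    rw [pow_succ' (R ^ 2 + R ^ k), add_mul]
    gcongr
    exact le_mul_of_one_le_right h2 h1

end System

lemma abs_add_one_le_two_pow_ratBits (q : ℚ) : |(q : ℝ)| + 1 ≤ 2 ^ ratBits q := by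
  have h1 : |(q : ℝ)| ≤ (q.num.natAbs : ℝ) := by
    have hd : (1 : ℝ) ≤ q.den := by exact_mod_cast q.pos
    rw [Rat.cast_def, abs_div, Nat.abs_cast, Nat.cast_natAbs, Int.cast_abs]
    exact div_le_self (abs_nonneg _) hd
  have h2 : q.num.natAbs + 1 ≤ 2 ^ ratBits q :=
    (Nat.succ_le_of_lt (Nat.lt_size_self _)).trans
      (Nat.pow_le_pow_right (by norm_num) (by unfold ratBits; omega))
  have h3 : (q.num.natAbs : ℝ) + 1 ≤ 2 ^ ratBits q := by exact_mod_cast h2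
  linarith

lemma den_le_two_pow_ratBits (q : ℚ) : q.den ≤ 2 ^ ratBits q :=
  (Nat.lt_size_self _).le.trans (Nat.pow_le_pow_right (by norm_num) (by unfold ratBits; omega))

section Rational

variable {n : ℕ}

lemma coeff_toReal (f : MvPolynomial (Fin n) ℚ) (a : Fin n →₀ ℕ) :
    coeff a (toReal f) = ((coeff a f : ℚ) : ℝ) := by
  rw [toReal, coeff_map]; rfl

lemma totalDegree_toReal_le (f : MvPolynomial (Fin n) ℚ) :
    (toReal f).totalDegree ≤ f.totalDegree :=
  Finset.sup_mono (support_map_subset _ _)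

lemma one_le_polyBits (f : MvPolynomial (Fin n) ℚ) : 1 ≤ polyBits f := Nat.le_add_right _ _

lemma ratBits_coeff_le (f : MvPolynomial (Fin n) ℚ) {a : Fin n →₀ ℕ} (ha : a ∈ f.support) :
    ratBits (coeff a f) ≤ polyBits f := by
  have := Finset.single_le_sum (f := fun a => ratBits (coeff a f) + monomialBits a)
    (fun _ _ => Nat.zero_le _) ha
  unfold polyBits
  omega

lemma den_coeff_le (f : MvPolynomial (Fin n) ℚ) (a : Fin n →₀ ℕ) :
    (coeff a f).den ≤ 2 ^ polyBits f := by
  by_cases ha : a ∈ f.support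
  · exact (den_le_two_pow_ratBits _).trans
      (Nat.pow_le_pow_right (by norm_num) (ratBits_coeff_le f ha))
  · rw [notMem_support_iff.mp ha]
    exact Nat.one_le_two_pow

lemma l1_toReal_le (f : MvPolynomial (Fin n) ℚ) : l1 (toReal f) ≤ 2 ^ polyBits f := by
  classical
  have key : ∀ s : Finset (Fin n →₀ ℕ), ∑ a ∈ s, |((coeff a f : ℚ) : ℝ)| + 1 ≤
      2 ^ ∑ a ∈ s, (ratBits (coeff a f) + monomialBits a) := by
    intro s
    induction s using Finset.induction_on with
    | empty => simp
    | insert a s ha ih =>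
      rw [Finset.sum_insert ha, Finset.sum_insert ha, pow_add]
      have h1 : |((coeff a f : ℚ) : ℝ)| + 1 ≤ 2 ^ (ratBits (coeff a f) + monomialBits a) :=
        (abs_add_one_le_two_pow_ratBits _).trans
          (pow_le_pow_right₀ one_le_two (Nat.le_add_right _ _))
      have h2 : 0 ≤ ∑ a ∈ s, |((coeff a f : ℚ) : ℝ)| := Finset.sum_nonneg fun _ _ => abs_nonneg _
      refine le_trans ?_ (mul_le_mul h1 ih (by positivity) (by positivity))
      nlinarith [abs_nonneg ((coeff a f : ℚ) : ℝ)]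
  rw [l1_eq_sum_of_subset (f := toReal f) (s := f.support) (support_map_subset _ _)]
  simp only [coeff_toReal]
  have h1 : (2 : ℝ) ^ ∑ a ∈ f.support, (ratBits (coeff a f) + monomialBits a) ≤ 2 ^ polyBits f :=
    pow_le_pow_right₀ one_le_two (Nat.le_add_left _ _)
  linarith [key f.support]

/-- A nonzero rational number of bounded denominator is not too small. -/
lemma one_le_abs_mul_of_den_le {x : ℚ} (hx : x ≠ 0) {N : ℕ} (hN : x.den ≤ N) :
    1 ≤ |(x : ℝ)| * N := by
  have h1 : (1 : ℝ) ≤ |(x.num : ℝ)| := by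
    exact_mod_cast Int.one_le_abs (Rat.num_ne_zero.mpr hx)
  have h2 : (x.num : ℝ) = x * x.den := by
    exact_mod_cast (Rat.mul_den_eq_num x).symm
  rw [h2, abs_mul, Nat.abs_cast] at h1
  refine h1.trans ?_
  gcongr

lemma den_mul_sub_mul_le {x y z w : ℚ} {N : ℕ} (hx : x.den ≤ N) (hy : y.den ≤ N) (hz : z.den ≤ N)
    (hw : w.den ≤ N) : (x * y - z * w).den ≤ N ^ 4 := by
  have h1 : (x * y).den ≤ N * N :=
    (Nat.le_of_dvd (Nat.mul_pos x.pos y.pos) (Rat.mul_den_dvd x y)).trans (Nat.mul_le_mul hx hy)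
  have h2 : (z * w).den ≤ N * N :=
    (Nat.le_of_dvd (Nat.mul_pos z.pos w.pos) (Rat.mul_den_dvd z w)).trans (Nat.mul_le_mul hz hw)
  refine (Nat.le_of_dvd (Nat.mul_pos (x * y).pos (z * w).pos) (Rat.sub_den_dvd _ _)).trans
    ((Nat.mul_le_mul h1 h2).trans_eq (by ring))

/-- If a rational polynomial is a real linear combination of two rational polynomials, then it is
one with coefficients bounded in terms of the bit sizes. -/
lemma exists_bounded_linear_combination {u f g : MvPolynomial (Fin n) ℚ} {β : ℕ}
    (hu : polyBits u ≤ β) (hf : polyBits f ≤ β) (hg : polyBits g ≤ β) {a b : ℝ}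
    (h : toReal u = C a * toReal f + C b * toReal g) :
    ∃ a' b' : ℝ, |a'| ≤ 2 ^ (6 * β + 1) ∧ |b'| ≤ 2 ^ (6 * β + 1) ∧
      toReal u = C a' * toReal f + C b' * toReal g := by
  have hc : ∀ x, ((coeff x u : ℚ) : ℝ) = a * ((coeff x f : ℚ) : ℝ) + b * coeff x g := fun x => by
    have := congrArg (coeff x) h
    simpa only [coeff_add, coeff_C_mul, coeff_toReal] using this
  have hB : ∀ v : MvPolynomial (Fin n) ℚ, polyBits v ≤ β → ∀ x, |((coeff x v : ℚ) : ℝ)| ≤ 2 ^ β :=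
    fun v hv x => by
      rw [← coeff_toReal]
      exact (abs_coeff_le_l1 _ _).trans ((l1_toReal_le v).trans (pow_le_pow_right₀ one_le_two hv))
  have hD : ∀ v : MvPolynomial (Fin n) ℚ, polyBits v ≤ β → ∀ x, (coeff x v).den ≤ 2 ^ β :=
    fun v hv x => (den_coeff_le v x).trans (Nat.pow_le_pow_right (by norm_num) hv)
  have h2 : (0 : ℝ) < 2 ^ β := by positivity
  have h21 : (1 : ℝ) ≤ 2 ^ β := one_le_pow₀ one_le_two
  have hpow : (2 : ℝ) ^ (6 * β + 1) = 2 * (2 ^ β * 2 ^ β) * (2 ^ β) ^ 4 := by ring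
  have quot : ∀ v : MvPolynomial (Fin n) ℚ, polyBits v ≤ β → ∀ x, coeff x v ≠ 0 →
      ∀ c : ℝ, ((coeff x u : ℚ) : ℝ) = c * ((coeff x v : ℚ) : ℝ) → |c| ≤ 2 ^ (6 * β + 1) := by
    intro v hv x hx c hcx
    have h3 := one_le_abs_mul_of_den_le hx (hD v hv x)
    push_cast at h3
    have h4 := hB u hu x
    rw [hcx, abs_mul] at h4
    have h5 : |c| ≤ 2 ^ β * 2 ^ β := by
      calc |c| ≤ |c| * (|((coeff x v : ℚ) : ℝ)| * 2 ^ β) := le_mul_of_one_le_right (abs_nonneg _) h3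
        _ = |c| * |((coeff x v : ℚ) : ℝ)| * 2 ^ β := by ring
        _ ≤ 2 ^ β * 2 ^ β := by gcongr
    refine h5.trans ?_
    rw [hpow]
    have : (1 : ℝ) ≤ (2 ^ β) ^ 4 := one_le_pow₀ h21
    nlinarith [mul_pos h2 h2]
  have hzero : |(0 : ℝ)| ≤ 2 ^ (6 * β + 1) := by rw [abs_zero]; positivity
  by_cases hind : ∃ x y, coeff x f * coeff y g - coeff y f * coeff x g ≠ 0
  · obtain ⟨x, y, hxy⟩ := hind
    have h3 := one_le_abs_mul_of_den_le hxy
      (den_mul_sub_mul_le (hD f hf x) (hD g hg y) (hD f hf y) (hD g hg x))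
    set Δ : ℝ := ((coeff x f * coeff y g - coeff y f * coeff x g : ℚ) : ℝ) with hΔ
    push_cast at h3 hΔ
    have bound : ∀ c s t : ℝ, c * Δ = s - t → |s| ≤ 2 ^ β * 2 ^ β → |t| ≤ 2 ^ β * 2 ^ β →
        |c| ≤ 2 ^ (6 * β + 1) := by
      intro c s t hcs hs ht
      have h5 : |c| * |Δ| ≤ 2 * (2 ^ β * 2 ^ β) := by
        rw [← abs_mul, hcs]
        have := abs_sub s t
        linarith
      calc |c| ≤ |c| * (|Δ| * (2 ^ β) ^ 4) := le_mul_of_one_le_right (abs_nonneg _) h3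
        _ = |c| * |Δ| * (2 ^ β) ^ 4 := by ring
        _ ≤ 2 ^ (6 * β + 1) := by rw [hpow]; gcongr
    refine ⟨a, b, ?_, ?_, h⟩
    · refine bound a (((coeff x u : ℚ) : ℝ) * ((coeff y g : ℚ) : ℝ)) (((coeff y u : ℚ) : ℝ) * ((coeff x g : ℚ) : ℝ)) ?_ ?_ ?_
      · rw [hΔ, hc x, hc y]; ring
      · rw [abs_mul]; exact mul_le_mul (hB u hu x) (hB g hg y) (abs_nonneg _) h2.le
      · rw [abs_mul]; exact mul_le_mul (hB u hu y) (hB g hg x) (abs_nonneg _) h2.le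
    · refine bound b (((coeff y u : ℚ) : ℝ) * ((coeff x f : ℚ) : ℝ)) (((coeff x u : ℚ) : ℝ) * ((coeff y f : ℚ) : ℝ)) ?_ ?_ ?_
      · rw [hΔ, hc x, hc y]; ring
      · rw [abs_mul]; exact mul_le_mul (hB u hu y) (hB f hf x) (abs_nonneg _) h2.le
      · rw [abs_mul]; exact mul_le_mul (hB u hu x) (hB f hf y) (abs_nonneg _) h2.le
  · push Not at hind
    by_cases hf0 : ∃ x, coeff x f ≠ 0
    · obtain ⟨x, hx⟩ := hf0
      have hxR : ((coeff x f : ℚ) : ℝ) ≠ 0 := by exact_mod_cast hx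
      have hcomb : ∀ y, ((coeff y u : ℚ) : ℝ) = (a + b * ((coeff x g : ℚ) : ℝ) / ((coeff x f : ℚ) : ℝ)) * coeff y f := by
        intro y
        have : ((coeff x f : ℚ) : ℝ) * ((coeff y g : ℚ) : ℝ) - ((coeff y f : ℚ) : ℝ) * ((coeff x g : ℚ) : ℝ) = 0 := by
          exact_mod_cast hind x y
        rw [hc y]
        field_simp
        linear_combination b * this
      refine ⟨_, 0, quot f hf x hx _ (hcomb x), hzero, ?_⟩
      ext y
      simp only [coeff_add, coeff_C_mul, coeff_toReal, zero_mul, add_zero]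
      exact hcomb y
    · push Not at hf0
      have hcomb : ∀ y, ((coeff y u : ℚ) : ℝ) = b * coeff y g := by
        intro y
        rw [hc y, hf0 y]; simp
      by_cases hg0 : ∃ x, coeff x g ≠ 0
      · obtain ⟨x, hx⟩ := hg0
        refine ⟨0, b, hzero, quot g hg x hx _ (hcomb x), ?_⟩
        ext y
        simp only [coeff_add, coeff_C_mul, coeff_toReal, zero_mul, zero_add]
        exact hcomb y
      · push Not at hg0
        refine ⟨0, 0, hzero, hzero, ?_⟩
        ext y
        simp only [coeff_add, coeff_C_mul, coeff_toReal, zero_mul, zero_add]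
        rw [hcomb y, hg0 y]; simp

end Rational

/-- Sum-of-squares proofs simulate polynomial calculus: the negated squares of the derived
polynomials have certificates of bounded coefficients. -/
theorem Cert.neg_sq_of_hasPCDerivation {n m k : ℕ} {ρ : Fin k → ℚ} {p : Fin m → Poly n}
    (hp : IsSystemOver ρ p) {β : ℕ} (hρ : ∀ i, ratBits (ρ i) ≤ β) {f : Poly n} {deg e : ℕ}
    (hf : HasPCDerivation ρ p f β deg) (he : 2 * deg + 2 * (k + 1) ≤ e) :
    Cert p e (2 ^ (((k + 12) * β + 4) * β)) (-f ^ 2) := by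
  obtain ⟨L, q, hstep, rfl, hsize, hdeg⟩ := hf
  have hR1 : (1 : ℝ) ≤ 2 ^ β := one_le_pow₀ one_le_two
  have hR : ∀ i, |(ρ i : ℝ)| + 1 ≤ 2 ^ β := fun i =>
    (abs_add_one_le_two_pow_ratBits _).trans (pow_le_pow_right₀ one_le_two (hρ i))
  have hbits : ∀ i, polyBits (q i) ≤ β := fun i =>
    (Finset.single_le_sum (f := fun i => polyBits (q i)) (fun _ _ => Nat.zero_le _)
      (Finset.mem_univ i)).trans hsize
  have hl1 : ∀ i, l1 (toReal (q i)) ≤ 2 ^ β := fun i =>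
    (l1_toReal_le _).trans (pow_le_pow_right₀ one_le_two (hbits i))
  have hdeg' : ∀ i, (toReal (q i)).totalDegree ≤ deg := fun i =>
    (totalDegree_toReal_le _).trans (hdeg i)
  have hL : L + 1 ≤ β := by
    refine le_trans ?_ hsize
    calc L + 1 = ∑ _i : Fin (L + 1), 1 := by simp
      _ ≤ _ := Finset.sum_le_sum fun i _ => one_le_polyBits _
  set Λ : ℝ := 2 ^ ((k + 12) * β + 4) with hΛ
  have hΛ1 : 1 ≤ Λ := one_le_pow₀ one_le_two
  have member : ∀ (i : Fin (L + 1)) (l : Fin m), p l = toReal (q i) →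
      Cert p e (Λ ^ (i.val + 1)) (-toReal (q i) ^ 2) := by
    intro i l hl
    have : Cert p e (2 ^ β) (-toReal (q i) * p l) := by
      refine Cert.eq_mul l ?_ (by rw [l1_neg]; exact hl1 i)
      rw [hl, neg_mul, totalDegree_neg]
      have := totalDegree_mul (toReal (q i)) (toReal (q i))
      have := hdeg' i
      omega
    rw [hl, neg_mul, ← pow_two] at this
    refine this.mono ?_
    calc (2 : ℝ) ^ β ≤ Λ := pow_le_pow_right₀ one_le_two (by nlinarith)
      _ ≤ Λ ^ (i.val + 1) := le_self_pow₀ hΛ1 (by omega)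
  have main : ∀ (N : ℕ) (i : Fin (L + 1)), i.val = N →
      Cert p e (Λ ^ (i.val + 1)) (-toReal (q i) ^ 2) := by
    intro N
    induction N using Nat.strong_induction_on with
    | _ N ih =>
    intro i hi
    have hprev : ∀ j : Fin (L + 1), j < i → Cert p e (Λ ^ i.val) (-toReal (q j) ^ 2) :=
      fun j hj => (ih j.val (hi ▸ hj) j rfl).mono (pow_le_pow_right₀ hΛ1 hj)
    have hΛi : 1 ≤ Λ ^ i.val := one_le_pow₀ hΛ1
    generalize hqi : toReal (q i) = u
    have hst := hstep i
    rw [hqi] at hst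
    cases hst with
    | member l => rw [← hqi]; exact member i l hqi.symm
    | domain j =>
      obtain ⟨l, hl⟩ := hp j
      rw [← hqi]
      exact member i l (hl.trans hqi.symm)
    | linear f g hf hg a b =>
      obtain ⟨jf, hjf, rfl⟩ := hf
      obtain ⟨jg, hjg, rfl⟩ := hg
      obtain ⟨a, b, ha, hb, hab⟩ :=
        exists_bounded_linear_combination (hbits i) (hbits jf) (hbits jg) hqi
      rw [← hqi, hab]
      have h1 := (hprev jf hjf).smul (c := 2 * a ^ 2) (by positivity)
      have h2 := (hprev jg hjg).smul (c := 2 * b ^ 2) (by positivity)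
      have h3 : Cert p e 0 ((C a * toReal (q jf) - C b * toReal (q jg)) ^ 2) := by
        refine Cert.sq ?_
        have a1 := totalDegree_sub (C a * toReal (q jf)) (C b * toReal (q jg))
        have a2 := (Cert.totalDegree_C_mul_le a (toReal (q jf))).trans (hdeg' jf)
        have a3 := (Cert.totalDegree_C_mul_le b (toReal (q jg))).trans (hdeg' jg)
        omega
      have := (h1.add h2).add h3
      have hid : -(C a * toReal (q jf) + C b * toReal (q jg)) ^ 2 =
          C (2 * a ^ 2) * -toReal (q jf) ^ 2 + C (2 * b ^ 2) * -toReal (q jg) ^ 2 +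
            (C a * toReal (q jf) - C b * toReal (q jg)) ^ 2 := by
        simp only [C_mul, C_pow, map_ofNat]
        ring
      rw [hid]
      refine this.mono ?_
      have ha2 : a ^ 2 ≤ 2 ^ (12 * β + 2) := by
        rw [← sq_abs]
        exact (pow_le_pow_left₀ (abs_nonneg _) ha 2).trans_eq (by ring)
      have hb2 : b ^ 2 ≤ 2 ^ (12 * β + 2) := by
        rw [← sq_abs]
        exact (pow_le_pow_left₀ (abs_nonneg _) hb 2).trans_eq (by ring)
      have hΛ2 : (4 : ℝ) * 2 ^ (12 * β + 2) ≤ Λ := by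
        calc (4 : ℝ) * 2 ^ (12 * β + 2) = 2 ^ (12 * β + 4) := by ring
          _ ≤ Λ := pow_le_pow_right₀ one_le_two (by nlinarith)
      rw [pow_succ' Λ]
      calc 2 * a ^ 2 * Λ ^ i.val + 2 * b ^ 2 * Λ ^ i.val + 0
          = (2 * a ^ 2 + 2 * b ^ 2) * Λ ^ i.val := by ring
        _ ≤ Λ * Λ ^ i.val := by gcongr; linarith
    | mul j f hf =>
      obtain ⟨jf, hjf, rfl⟩ := hf
      have h1 := hprev jf hjf
      rw [← zero_sub] at h1
      have h2 := Cert.sub_sq_X_mul hp hR1 hR h1 (by have := hdeg' jf; omega) j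
      rw [mul_zero, zero_sub] at h2
      refine h2.mono ?_
      have h3 : ((2 : ℝ) ^ β) ^ k * l1 (toReal (q jf)) ^ 2 ≤ 2 ^ ((k + 2) * β) := by
        calc ((2 : ℝ) ^ β) ^ k * l1 (toReal (q jf)) ^ 2 ≤ (2 ^ β) ^ k * (2 ^ β) ^ 2 := by
              gcongr
              exacts [l1_nonneg _, hl1 jf]
          _ = 2 ^ ((k + 2) * β) := by ring
      have h4 : ((2 : ℝ) ^ β) ^ 2 ≤ 2 ^ ((k + 2) * β) := by
        rw [← pow_mul]
        exact pow_le_pow_right₀ one_le_two (by nlinarith)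
      have h5 : (2 : ℝ) * 2 ^ ((k + 2) * β) ≤ Λ := by
        rw [← pow_succ']
        exact pow_le_pow_right₀ one_le_two (by nlinarith)
      rw [pow_succ' Λ]
      have h6 : (0 : ℝ) ≤ 2 ^ ((k + 2) * β) := by positivity
      calc ((2 : ℝ) ^ β) ^ 2 * Λ ^ i.val + (2 ^ β) ^ k * l1 (toReal (q jf)) ^ 2
          ≤ 2 ^ ((k + 2) * β) * Λ ^ i.val + 2 ^ ((k + 2) * β) * Λ ^ i.val := by
            refine add_le_add (by gcongr) (h3.trans (le_mul_of_one_le_right h6 hΛi))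
        _ = (2 * 2 ^ ((k + 2) * β)) * Λ ^ i.val := by ring
        _ ≤ Λ * Λ ^ i.val := by gcongr
  refine (main _ (Fin.last L) rfl).mono ?_
  rw [pow_mul]
  exact pow_le_pow_right₀ hΛ1 (by simpa using hL)

lemma one_le_abs_det_map_intCast {κ : Type*} [Fintype κ] [DecidableEq κ] (A : Matrix κ κ ℤ)
    (h : (A.map (Int.cast : ℤ → ℝ)).det ≠ 0) : 1 ≤ |(A.map (Int.cast : ℤ → ℝ)).det| := by
  have he : (A.map (Int.cast : ℤ → ℝ)).det = (A.det : ℝ) := (Int.cast_det A).symm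
  rw [he] at h ⊢
  exact_mod_cast Int.one_le_abs (Int.cast_ne_zero.mp h)

/-- A bound for the inverse of an invertible integer matrix, by the rule of Cramer. -/
lemma abs_inv_map_intCast_le {κ : Type*} [Fintype κ] [DecidableEq κ] (A : Matrix κ κ ℤ)
    (h : (A.map (Int.cast : ℤ → ℝ)).det ≠ 0) {K : ℝ} (hK : 1 ≤ K) (hA : ∀ i j, |(A i j : ℝ)| ≤ K)
    (i j : κ) :
    |(A.map (Int.cast : ℤ → ℝ))⁻¹ i j| ≤ (Fintype.card κ).factorial * K ^ Fintype.card κ := by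
  set M := A.map (Int.cast : ℤ → ℝ) with hM
  have h1 : 1 ≤ |M.det| := one_le_abs_det_map_intCast A h
  have h2 : |M.adjugate i j| ≤ (Fintype.card κ).factorial * K ^ Fintype.card κ := by
    rw [Matrix.adjugate_apply, ← nsmul_eq_mul]
    refine Matrix.det_le (abv := AbsoluteValue.abs) fun i' j' => ?_
    change |M.updateRow j (Pi.single i 1) i' j'| ≤ K
    rw [Matrix.updateRow_apply]
    split_ifs
    · rw [Pi.single_apply]
      split_ifs
      · simpa using hK
      · simpa using zero_le_one.trans hK
    · exact hA i' j'
  rw [Matrix.inv_def, Matrix.smul_apply, smul_eq_mul, abs_mul, Ring.inverse_eq_inv', abs_inv]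
  refine le_trans ?_ h2
  exact mul_le_of_le_one_left (abs_nonneg _) (inv_le_one_of_one_le₀ h1)

/-- Every vector can be replaced by one with the same image under an integer matrix that is
obtained from finitely many entries of the image by a linear map of bounded coefficients. -/
lemma exists_bounded_interpolation {Y ι : Type*} [Fintype ι] (E : Y → ι → ℤ) {K : ℝ} (hK : 1 ≤ K)
    (hE : ∀ y a, |(E y a : ℝ)| ≤ K) :
    ∃ (κ : Type) (_ : Fintype κ) (a : κ → ι) (y : κ → Y) (L : κ → κ → ℝ),
      Fintype.card κ ≤ Fintype.card ι ∧
      (∀ i j, |L i j| ≤ (Fintype.card κ).factorial * K ^ Fintype.card κ) ∧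
      ∀ (v : ι → ℝ) (z : Y),
        ∑ i, (E z (a i) : ℝ) * ∑ j, L i j * ∑ b, (E (y j) b : ℝ) * v b =
          ∑ b, (E z b : ℝ) * v b := by
  classical
  let col : ι → Y → ℝ := fun a y => E y a
  obtain ⟨κ₀, a₀, ha₀, hspan₀, hind₀⟩ := exists_linearIndependent' ℝ col
  have : Finite κ₀ := Finite.of_injective a₀ ha₀
  obtain ⟨r, ⟨σ⟩⟩ := Finite.exists_equiv_fin κ₀
  let a : Fin r → ι := a₀ ∘ σ.symm
  have hind : LinearIndependent ℝ (col ∘ a) := hind₀.comp _ σ.symm.injective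
  have hspan : Submodule.span ℝ (Set.range (col ∘ a)) = Submodule.span ℝ (Set.range col) := by
    rw [← hspan₀, ← σ.symm.surjective.range_comp (col ∘ a₀)]; rfl
  have hcard : r ≤ Fintype.card ι := by
    simpa using Fintype.card_le_of_injective a (ha₀.comp σ.symm.injective)
  let row : Y → Fin r → ℝ := fun y i => E y (a i)
  have htop : Submodule.span ℝ (Set.range row) = ⊤ := by
    by_contra hne
    obtain ⟨φ, hφ, hker⟩ := Submodule.exists_le_ker_of_lt_top _ (lt_top_iff_ne_top.mpr hne)
    apply hφ
    have hφe : ∀ w : Fin r → ℝ, φ w = ∑ i, w i * φ (Pi.single i 1) := fun w => by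
      conv_lhs => rw [pi_eq_sum_univ' w]
      rw [map_sum]
      exact Finset.sum_congr rfl fun i _ => by rw [map_smul, smul_eq_mul]
    have hz := Fintype.linearIndependent_iff.mp hind (fun i => φ (Pi.single i 1)) (by
      funext y
      have : φ (row y) = 0 := hker (Submodule.subset_span ⟨y, rfl⟩)
      rw [hφe] at this
      rw [Finset.sum_apply]
      refine Eq.trans (Finset.sum_congr rfl fun i _ => ?_) this
      change _ * (E y (a i) : ℝ) = _
      rw [mul_comm])
    ext w
    simp [hz]
  obtain ⟨κ₁, y₀, hy₀, hspan₁, hind₁⟩ := exists_linearIndependent' ℝ row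
  let bas : Module.Basis κ₁ ℝ (Fin r → ℝ) := Module.Basis.mk hind₁ (by rw [hspan₁, htop])
  let τ : Fin r ≃ κ₁ := (Pi.basisFun ℝ (Fin r)).indexEquiv bas
  let y : Fin r → Y := y₀ ∘ τ
  let A : Matrix (Fin r) (Fin r) ℤ := fun i j => E (y i) (a j)
  let M : Matrix (Fin r) (Fin r) ℝ := A.map (Int.cast : ℤ → ℝ)
  have hrow : LinearIndependent ℝ M.row := hind₁.comp _ τ.injective
  have hunit : IsUnit M := Matrix.linearIndependent_rows_iff_isUnit.mp hrow
  have hdet : IsUnit M.det := (Matrix.isUnit_iff_isUnit_det M).mp hunit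
  refine ⟨Fin r, inferInstance, a, y, fun i j => M⁻¹ i j, by simpa using hcard,
    fun i j => abs_inv_map_intCast_le A hdet.ne_zero hK (fun i j => hE _ _) i j, fun v z => ?_⟩
  have hmem : ∑ b, v b • col b ∈ Submodule.span ℝ (Set.range (col ∘ a)) := by
    rw [hspan]
    exact Submodule.sum_mem _ fun b _ => Submodule.smul_mem _ _ (Submodule.subset_span ⟨b, rfl⟩)
  obtain ⟨w, hw⟩ := (Submodule.mem_span_range_iff_exists_fun ℝ).mp hmem
  have hw' : ∀ x, ∑ i, (E x (a i) : ℝ) * w i = ∑ b, (E x b : ℝ) * v b := fun x => by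
    have := congrFun hw x
    simp only [Finset.sum_apply, Pi.smul_apply, smul_eq_mul, Function.comp_apply, col] at this
    simpa only [mul_comm] using this
  have hsol : ∀ i, ∑ j, M⁻¹ i j * ∑ b, (E (y j) b : ℝ) * v b = w i := by
    intro i
    have h1 : M⁻¹.mulVec (M.mulVec w) = w := by
      rw [Matrix.mulVec_mulVec, Matrix.nonsing_inv_mul _ hdet, Matrix.one_mulVec]
    have h2 := congrFun h1 i
    rw [← h2]
    exact Finset.sum_congr rfl fun j _ => by rw [← hw' (y j)]; rfl
  rw [← hw' z]
  exact Finset.sum_congr rfl fun i _ => by rw [hsol]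

/-- The monomials of bounded degree. -/
lemma exists_finset_monomials (n D : ℕ) :
    ∃ s : Finset (Fin n →₀ ℕ), s.card ≤ (n + 1) ^ D ∧ ∀ a, a ∈ s ↔ a.degree ≤ D := by
  classical
  suffices h : ∃ s : Finset (Fin n →₀ ℕ), s.card ≤ (n + 1) ^ D ∧ ∀ a, a.degree ≤ D → a ∈ s by
    obtain ⟨s, hs, hmem⟩ := h
    refine ⟨s.filter fun a => a.degree ≤ D, (Finset.card_filter_le _ _).trans hs, fun a => ?_⟩
    rw [Finset.mem_filter]
    exact ⟨fun h => h.2, fun h => ⟨hmem a h, h⟩⟩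
  induction D with
  | zero =>
    refine ⟨{0}, by simp, fun a ha => ?_⟩
    rw [Finset.mem_singleton]
    exact (Finsupp.degree_eq_zero_iff a).mp (Nat.le_zero.mp ha)
  | succ D ih =>
    obtain ⟨s, hs, hmem⟩ := ih
    refine ⟨s ∪ Finset.univ.biUnion fun j : Fin n => s.image (Finsupp.single j 1 + ·), ?_,
      fun a ha => ?_⟩
    · refine (Finset.card_union_le _ _).trans ?_
      have h1 := Finset.card_biUnion_le_card_mul (Finset.univ : Finset (Fin n))
        (fun j : Fin n => s.image (Finsupp.single j 1 + ·)) s.card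
        (fun j _ => Finset.card_image_le)
      rw [Finset.card_univ, Fintype.card_fin] at h1
      calc _ ≤ s.card + n * s.card := Nat.add_le_add_left h1 _
        _ = (n + 1) * s.card := by ring
        _ ≤ (n + 1) * (n + 1) ^ D := Nat.mul_le_mul_left _ hs
        _ = (n + 1) ^ (D + 1) := by ring
    · rw [Finset.mem_union]
      by_cases ha0 : a = 0
      · left; subst ha0; exact hmem _ (by simp)
      · right
        obtain ⟨j, hj⟩ := Finsupp.support_nonempty_iff.mpr ha0
        have hle : Finsupp.single j 1 ≤ a := by
          rw [Finsupp.single_le_iff]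
          exact Nat.one_le_iff_ne_zero.mpr (Finsupp.mem_support_iff.mp hj)
        obtain ⟨b, rfl⟩ := exists_add_of_le hle
        rw [map_add, Finsupp.degree_single] at ha
        exact Finset.mem_biUnion.mpr ⟨j, Finset.mem_univ _,
          Finset.mem_image.mpr ⟨b, hmem b (by omega), rfl⟩⟩

lemma support_subset_of_totalDegree_le {n D : ℕ} {s : Finset (Fin n →₀ ℕ)}
    (hs : ∀ a, a ∈ s ↔ a.degree ≤ D) {f : Poly n} (hf : f.totalDegree ≤ D) : f.support ⊆ s :=
  fun a ha => (hs a).mpr ((le_totalDegree ha).trans hf)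

section Points

variable {n m k : ℕ} {ρ : Fin k → ℚ} {p : Fin m → Poly n}

lemma exists_eq_of_mem_variety (hp : IsSystemOver ρ p) {x : Fin n → ℝ} (hx : x ∈ variety p)
    (j : Fin n) : ∃ i, x j = ρ i := by
  obtain ⟨l, hl⟩ := hp j
  have := hx l
  rw [hl, domainPoly, map_prod] at this
  obtain ⟨i, -, hi⟩ := Finset.prod_eq_zero_iff.mp this
  exact ⟨i, sub_eq_zero.mp (by simpa using hi)⟩

lemma exists_int_eq_prod_den_mul (ρ : Fin k → ℚ) (i : Fin k) :
    ∃ z : ℤ, ((∏ l, (ρ l).den : ℕ) : ℝ) * ρ i = z := by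
  obtain ⟨t, ht⟩ := Finset.dvd_prod_of_mem (fun l => (ρ l).den) (Finset.mem_univ i)
  refine ⟨t * (ρ i).num, ?_⟩
  have h : (((ρ i).num : ℚ) : ℝ) = ((ρ i * (ρ i).den : ℚ) : ℝ) := by rw [Rat.mul_den_eq_num]
  push_cast at h
  rw [ht]
  push_cast
  rw [h]
  ring

lemma exists_int_eq_pow_mul_eval_monomial {x : Fin n → ℝ} {q : ℝ} (hq : ∃ z : ℤ, q = z)
    (hx : ∀ j, ∃ z : ℤ, q * x j = z) {d : ℕ} {a : Fin n →₀ ℕ} (ha : a.degree ≤ d) :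
    ∃ z : ℤ, (z : ℝ) = q ^ d * eval x (monomial a 1) := by
  have hmem : q ^ (d - a.degree) * ∏ j ∈ a.support, (q * x j) ^ a j ∈ (Int.castRingHom ℝ).range := by
    refine Subring.mul_mem _ (Subring.pow_mem _ ?_ _)
      (Subring.prod_mem _ fun j _ => Subring.pow_mem _ ?_ _)
    · obtain ⟨z, hz⟩ := hq; exact ⟨z, by simp [hz]⟩
    · obtain ⟨z, hz⟩ := hx j; exact ⟨z, by simp [hz]⟩
  obtain ⟨z, hz⟩ := hmem
  refine ⟨z, ?_⟩
  have hz' : (z : ℝ) = q ^ (d - a.degree) * ∏ j ∈ a.support, (q * x j) ^ a j := hz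
  have hsplit : ∏ j ∈ a.support, (q * x j) ^ a j =
      q ^ a.degree * ∏ j ∈ a.support, x j ^ a j := by
    simp only [mul_pow]
    rw [Finset.prod_mul_distrib, Finset.prod_pow_eq_pow_sum]
    rfl
  rw [hz', eval_monomial, one_mul, hsplit, ← mul_assoc, ← pow_add, Nat.sub_add_cancel ha]
  rfl

/-- Polynomials of degree `d` can be replaced by polynomials with the same values on the variety
whose coefficients are bounded in terms of these values. -/
theorem exists_bounded_representatives (hp : IsSystemOver ρ p) {β : ℕ}
    (hρ : ∀ i, ratBits (ρ i) ≤ β) {d N : ℕ} (hN : (n + 1) ^ d ≤ N) {t : ℕ} (s : Fin t → Poly n)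
    (hs : ∀ i, (s i).totalDegree ≤ d) {V : ℝ}
    (hV : ∀ x ∈ variety p, ∑ i, eval x (s i) ^ 2 ≤ V) (hV0 : 0 ≤ V) :
    ∃ s' : Fin t → Poly n, (∀ i, (s' i).totalDegree ≤ d) ∧
      (∀ i, ∀ x ∈ variety p, eval x (s' i) = eval x (s i)) ∧
      ∑ i, l1 (s' i) ^ 2 ≤
        N ^ 4 * (N ^ N * (2 ^ ((k + 1) * β * d)) ^ N * 2 ^ (k * β * d)) ^ 2 * V := by
  classical
  obtain ⟨mon, hmonc, hmon⟩ := exists_finset_monomials n d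
  set q : ℕ := ∏ l, (ρ l).den with hqdef
  have hq0 : 0 < q := Finset.prod_pos fun l _ => (ρ l).pos
  have hqle : q ≤ 2 ^ (k * β) := by
    calc q ≤ ∏ _l : Fin k, 2 ^ β := Finset.prod_le_prod' fun l _ =>
          (den_le_two_pow_ratBits _).trans (Nat.pow_le_pow_right (by norm_num) (hρ l))
      _ = 2 ^ (k * β) := by simp [← pow_mul, mul_comm]
  have hqR : (q : ℝ) ^ d ≤ 2 ^ (k * β * d) := by
    rw [pow_mul]
    exact pow_le_pow_left₀ (Nat.cast_nonneg _) (by exact_mod_cast hqle) d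
  have hqd0 : (0 : ℝ) < (q : ℝ) ^ d := by positivity
  have hinteger : ∀ (x : variety p) (a : mon), ∃ z : ℤ,
      (z : ℝ) = (q : ℝ) ^ d * eval x.1 (monomial a.1 1) := fun x a => by
    refine exists_int_eq_pow_mul_eval_monomial ⟨q, by simp⟩ (fun j => ?_) ((hmon _).mp a.2)
    obtain ⟨i, hi⟩ := exists_eq_of_mem_variety hp x.2 j
    rw [hi]
    exact exists_int_eq_prod_den_mul ρ i
  choose E hE using hinteger
  have hxle : ∀ x ∈ variety p, ∀ j, |x j| ≤ (2 : ℝ) ^ β := fun x hx j => by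
    obtain ⟨i, hi⟩ := exists_eq_of_mem_variety hp hx j
    rw [hi]
    have h1 := abs_add_one_le_two_pow_ratBits (ρ i)
    have h2 : (2 : ℝ) ^ ratBits (ρ i) ≤ 2 ^ β := pow_le_pow_right₀ one_le_two (hρ i)
    linarith
  set K : ℝ := 2 ^ ((k + 1) * β * d) with hK
  have hK1 : 1 ≤ K := one_le_pow₀ one_le_two
  have hEK : ∀ x a, |(E x a : ℝ)| ≤ K := fun x a => by
    rw [hE, abs_mul, abs_of_pos hqd0]
    have h1 : |eval x.1 (monomial a.1 (1 : ℝ))| ≤ 1 * (2 ^ β) ^ d := by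
      have := abs_eval_le (f := monomial a.1 (1 : ℝ)) (D := d)
        ((totalDegree_monomial_le _ _).trans ((hmon _).mp a.2)) (one_le_pow₀ one_le_two)
        (hxle x.1 x.2)
      rwa [l1_monomial, abs_one] at this
    calc (q : ℝ) ^ d * |eval x.1 (monomial a.1 (1 : ℝ))| ≤ 2 ^ (k * β * d) * (1 * (2 ^ β) ^ d) :=
          mul_le_mul hqR h1 (abs_nonneg _) (by positivity)
      _ = K := by rw [hK]; ring
  obtain ⟨κ, _, a, y, L, hcard, hL, hLE⟩ := exists_bounded_interpolation E hK1 hEK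
  set r := Fintype.card κ with hr
  have hrN : r ≤ N := by
    refine hcard.trans ?_
    rw [Fintype.card_coe]
    exact hmonc.trans hN
  have hev : ∀ (f : Poly n), f.totalDegree ≤ d → ∀ x : variety p,
      ∑ b : mon, (E x b : ℝ) * coeff b.1 f = (q : ℝ) ^ d * eval x.1 f := fun f hf x => by
    have h1 : f = ∑ b : mon, monomial b.1 (coeff b.1 f) := by
      rw [Finset.sum_coe_sort mon fun b => monomial b (coeff b f)]
      conv_lhs => rw [f.as_sum]
      refine Finset.sum_subset (support_subset_of_totalDegree_le hmon hf) fun b _ hb => ?_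
      rw [notMem_support_iff.mp hb, monomial_zero]
    conv_rhs => rw [h1]
    rw [map_sum, Finset.mul_sum]
    refine Finset.sum_congr rfl fun b _ => ?_
    rw [hE, eval_monomial, eval_monomial]
    ring
  set Lmax : ℝ := N ^ N * K ^ N with hLmax
  have hLmax0 : 0 ≤ Lmax := by positivity
  have hLle : ∀ i j, |L i j| ≤ Lmax := fun i j => by
    refine (hL i j).trans (mul_le_mul ?_ (pow_le_pow_right₀ hK1 hrN) (by positivity)
      (by positivity))
    have h1 : r.factorial ≤ N ^ N :=
      (Nat.factorial_le hrN).trans (Nat.factorial_le_pow N)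
    exact_mod_cast h1
  let s' : Fin t → Poly n := fun i =>
    ∑ u, monomial (a u).1 (∑ j, L u j * ((q : ℝ) ^ d * eval (y j).1 (s i)))
  refine ⟨s', fun i => ?_, fun i x hx => ?_, ?_⟩
  · refine totalDegree_finsetSum_le fun u _ => ?_
    exact (totalDegree_monomial_le _ _).trans ((hmon _).mp (a u).2)
  · have h1 := hLE (fun b => coeff b.1 (s i)) ⟨x, hx⟩
    simp only [hev _ (hs i)] at h1
    refine mul_left_cancel₀ hqd0.ne' ?_
    rw [← h1]
    change (q : ℝ) ^ d * eval x (∑ u, _) = _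
    rw [map_sum, Finset.mul_sum]
    refine Finset.sum_congr rfl fun u _ => ?_
    rw [hE, eval_monomial, eval_monomial]
    ring
  · have hone : ∀ i, l1 (s' i) ^ 2 ≤
        (N * (Lmax * 2 ^ (k * β * d))) ^ 2 * (N * ∑ j, eval (y j).1 (s i) ^ 2) := by
      intro i
      have h1 : l1 (s' i) ≤ N * (Lmax * 2 ^ (k * β * d)) * ∑ j, |eval (y j).1 (s i)| := by
        refine (l1_sum_le _ _).trans ?_
        have h2 : ∀ u ∈ (Finset.univ : Finset κ),
            l1 (monomial (a u).1 (∑ j, L u j * ((q : ℝ) ^ d * eval (y j).1 (s i)))) ≤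
              (Lmax * 2 ^ (k * β * d)) * ∑ j, |eval (y j).1 (s i)| := by
          intro u _
          rw [l1_monomial, Finset.mul_sum]
          refine (Finset.abs_sum_le_sum_abs _ _).trans (Finset.sum_le_sum fun j _ => ?_)
          rw [abs_mul, abs_mul, abs_of_pos hqd0, mul_assoc]
          have := hLle u j
          gcongr
        refine (Finset.sum_le_card_nsmul _ _ _ h2).trans ?_
        rw [nsmul_eq_mul, Finset.card_univ, mul_assoc (N : ℝ)]
        have : (r : ℝ) ≤ N := by exact_mod_cast hrN
        have h3 : 0 ≤ ∑ j, |eval (y j).1 (s i)| := Finset.sum_nonneg fun _ _ => abs_nonneg _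
        gcongr
      refine (pow_le_pow_left₀ (l1_nonneg _) h1 2).trans ?_
      rw [mul_pow]
      refine mul_le_mul_of_nonneg_left ?_ (by positivity)
      refine sq_sum_le_card_mul_sum_sq.trans ?_
      simp only [sq_abs]
      have : (r : ℝ) ≤ N := by exact_mod_cast hrN
      have h3 : 0 ≤ ∑ j, eval (y j).1 (s i) ^ 2 := Finset.sum_nonneg fun _ _ => sq_nonneg _
      rw [Finset.card_univ]
      gcongr
    refine (Finset.sum_le_sum fun i _ => hone i).trans ?_
    rw [← Finset.mul_sum, ← Finset.mul_sum, Finset.sum_comm]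
    have h1 : ∑ j, ∑ i, eval (y j).1 (s i) ^ 2 ≤ N * V := by
      refine (Finset.sum_le_card_nsmul _ _ V fun j _ => hV _ (y j).2).trans ?_
      rw [nsmul_eq_mul, Finset.card_univ]
      have : (r : ℝ) ≤ N := by exact_mod_cast hrN
      gcongr
    calc _ ≤ (N * (Lmax * 2 ^ (k * β * d))) ^ 2 * (N * (N * V)) := by gcongr
      _ = _ := by rw [hLmax]; ring

end Points

/-- A bounded multiple of a polynomial `g` is nonnegative up to a small error, provided that `-g²`
has a certificate. -/
lemma Cert.monomial_mul_add_const {n m k : ℕ} {ρ : Fin k → ℚ} {p : Fin m → Poly n} {e : ℕ}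
    {R : ℝ} (hp : IsSystemOver ρ p) (hR1 : 1 ≤ R) (hR : ∀ i, |(ρ i : ℝ)| + 1 ≤ R) {D : ℕ}
    (he : 2 * D + 2 * (k + 1) ≤ e) {g : Poly n} (hgD : g.totalDegree ≤ D) {P : ℝ} (hP : 0 ≤ P)
    (hg : Cert p e P (-g ^ 2)) {a : Fin n →₀ ℕ} (ha : a.degree ≤ D) {c Γ δ : ℝ} (hΓ : 0 < Γ)
    (hc : |c| ≤ Γ) (hδ : 0 < δ) (hδ1 : δ ≤ 1) :
    Cert p e ((R ^ 2 + R ^ k) ^ D + Γ ^ 2 * (R ^ 2) ^ D / δ * P) (monomial a c * g + C δ) := by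
  have hM1 : 1 ≤ (R ^ 2) ^ D := one_le_pow₀ (one_le_pow₀ hR1)
  have hM0 : 0 < (R ^ 2) ^ D := by positivity
  set A : ℝ := δ / (Γ ^ 2 * (R ^ 2) ^ D) with hA
  have hA0 : 0 < A := by positivity
  have hc2 : c ^ 2 ≤ Γ ^ 2 := by
    rw [← sq_abs]; exact pow_le_pow_left₀ (abs_nonneg _) hc 2
  have hAc : A * c ^ 2 * (R ^ 2) ^ D ≤ δ := by
    calc A * c ^ 2 * (R ^ 2) ^ D ≤ A * Γ ^ 2 * (R ^ 2) ^ D := by gcongr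
      _ = δ := by rw [hA]; field_simp
  have hAc1 : A * c ^ 2 ≤ 1 :=
    (le_mul_of_one_le_right (by positivity) hM1).trans (hAc.trans hδ1)
  have hmona : (R ^ 2) ^ a.degree ≤ (R ^ 2) ^ D := pow_le_pow_right₀ (one_le_pow₀ hR1) ha
  have hdm : (monomial a c).totalDegree ≤ D := (totalDegree_monomial_le _ _).trans ha
  have h1 : Cert p e (A / 2 * 0) (C (A / 2) * (monomial a c + C A⁻¹ * g) ^ 2) := by
    refine Cert.smul (by positivity) (Cert.sq ?_)
    have a1 := totalDegree_add (monomial a c) (C A⁻¹ * g)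
    have a2 := (Cert.totalDegree_C_mul_le A⁻¹ g).trans hgD
    omega
  have h2 := (Cert.const_sub_monomial_sq hp hR1 hR he a ha).smul (c := A * c ^ 2 / 2)
    (by positivity)
  have h3 := hg.smul (c := A⁻¹ / 2) (by positivity)
  have h4 : Cert p e 0 (C (δ - A * c ^ 2 / 2 * (R ^ 2) ^ a.degree)) := by
    refine Cert.const ?_
    have : A * c ^ 2 * (R ^ 2) ^ a.degree ≤ A * c ^ 2 * (R ^ 2) ^ D := by gcongr
    have : 0 ≤ A * c ^ 2 * (R ^ 2) ^ a.degree := by positivity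
    linarith
  have h5 := ((h1.add h2).add h3).add h4
  have hid : monomial a c * g + C δ = C (A / 2) * (monomial a c + C A⁻¹ * g) ^ 2 +
      C (A * c ^ 2 / 2) * (C ((R ^ 2) ^ a.degree) - monomial a 1 ^ 2) +
      C (A⁻¹ / 2) * -g ^ 2 + C (δ - A * c ^ 2 / 2 * (R ^ 2) ^ a.degree) := by
    have e1 : (monomial a c : Poly n) = C c * monomial a 1 := by rw [C_mul_monomial, mul_one]
    have e2 : (C A : Poly n) * C A⁻¹ = 1 := by
      rw [← C_mul, mul_inv_cancel₀ hA0.ne', C_1]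
    have e3 : (C (2⁻¹ : ℝ) : Poly n) * 2 = 1 := by
      rw [← map_ofNat (C : ℝ →+* Poly n) 2, ← C_mul]; norm_num
    simp only [e1, div_eq_mul_inv, C_sub, C_mul, C_pow]
    linear_combination (-C c * monomial a 1 * g * 2 * C (2⁻¹ : ℝ)
      - C A⁻¹ * g ^ 2 * C (2⁻¹ : ℝ)) * e2 - C c * monomial a 1 * g * e3
  rw [hid]
  refine h5.mono ?_
  have b1 : (R ^ 2 + R ^ k) ^ a.degree ≤ (R ^ 2 + R ^ k) ^ D := by
    refine pow_le_pow_right₀ ?_ ha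
    have := one_le_pow₀ hR1 (n := 2)
    have : 0 ≤ R ^ k := by positivity
    linarith
  have b2 : A⁻¹ = Γ ^ 2 * (R ^ 2) ^ D / δ := by rw [hA, inv_div]
  have b3 : A * c ^ 2 / 2 * (R ^ 2 + R ^ k) ^ a.degree ≤ 1 * (R ^ 2 + R ^ k) ^ D :=
    mul_le_mul (by linarith) b1 (by positivity) zero_le_one
  have b4 : A⁻¹ / 2 * P ≤ A⁻¹ * P := by
    have : 0 < A⁻¹ := by positivity
    gcongr
    linarith
  rw [b2] at b4 ⊢
  linarith

section Reduction

variable {n m k : ℕ} {ρ : Fin k → ℚ} {p : Fin m → Poly n} {e D : ℕ} {R H P Γ δ : ℝ}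
  {I : Ideal (Poly n)} {G : Finset (Poly n)} {mon : Finset (Fin n →₀ ℕ)}

/-- Division by a truncated Gröbner basis, as a certificate up to a small error. -/
theorem Cert.add_const_of_mem_ideal (hp : IsSystemOver ρ p) (hR1 : 1 ≤ R)
    (hR : ∀ i, |(ρ i : ℝ)| + 1 ≤ R) (he : 2 * D + 2 * (k + 1) ≤ e)
    (hmon : ∀ a, a ∈ mon ↔ a.degree ≤ D) (hG : IsGroebnerBasis I G) (hH : 0 < H) (hP : 0 ≤ P)
    (hl1 : ∀ g ∈ G, g.totalDegree ≤ D → l1 g ≤ H)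
    (hcoeff : ∀ g ∈ G, g.totalDegree ≤ D → ∀ a, coeff a g ≠ 0 → 1 ≤ |coeff a g| * H)
    (hcert : ∀ g ∈ G, g.totalDegree ≤ D → Cert p e P (-g ^ 2))
    (hΓ : 0 < Γ) (hδ : 0 < δ) (hδ1 : δ ≤ 1) (t : ℕ) (f : Poly n) (hfI : f ∈ I)
    (hfD : f.totalDegree ≤ D)
    (hcard : f = 0 ∨ (mon.filter fun a => MonomialOrder.degLex.toSyn a ≤
      MonomialOrder.degLex.toSyn (MonomialOrder.degLex.degree f)).card ≤ t)
    (hf : l1 f * (1 + H ^ 2) ^ t ≤ Γ) :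
    Cert p e (t * ((R ^ 2 + R ^ k) ^ D + (Γ * H) ^ 2 * (R ^ 2) ^ D / δ * P)) (f + C (t * δ)) := by
  set B : ℝ := (R ^ 2 + R ^ k) ^ D + (Γ * H) ^ 2 * (R ^ 2) ^ D / δ * P with hB
  have hB0 : 0 ≤ B := by positivity
  induction t generalizing f with
  | zero =>
    have hf0 : f = 0 := by
      refine hcard.resolve_right fun h => ?_
      rw [Nat.le_zero, Finset.card_eq_zero] at h
      have : MonomialOrder.degLex.degree f ∈ mon.filter fun a => MonomialOrder.degLex.toSyn a ≤
          MonomialOrder.degLex.toSyn (MonomialOrder.degLex.degree f) :=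
        Finset.mem_filter.mpr ⟨(hmon _).mpr (by rwa [degree_degLexDegree]), le_rfl⟩
      rw [h] at this
      exact Finset.notMem_empty _ this
    subst hf0
    simpa using Cert.zero
  | succ t ih =>
    by_cases hf0 : f = 0
    · subst hf0
      rw [zero_add]
      exact (Cert.const (by positivity)).mono (by positivity)
    obtain ⟨g, hgG, hg0, hgf⟩ := hG.2 f hfI hf0
    set df := MonomialOrder.degLex.degree f with hdf
    set dg := MonomialOrder.degLex.degree g with hdg
    have hdfD : df.degree ≤ D := by rwa [hdf, degree_degLexDegree]
    have hsplit : (df - dg).degree + dg.degree = df.degree := by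
      rw [← map_add, tsub_add_cancel_of_le hgf]
    have hgdeg : g.totalDegree = dg.degree := degree_degLexDegree.symm
    have hgD : g.totalDegree ≤ D := by omega
    have hlg0 : coeff dg g ≠ 0 := MonomialOrder.coeff_degree_ne_zero_iff.mpr hg0
    have hunit : IsUnit (MonomialOrder.degLex.leadingCoeff g) := isUnit_iff_ne_zero.mpr hlg0
    set c : ℝ := (coeff dg g)⁻¹ * coeff df f with hc
    have hfac := hcoeff g hgG hgD dg hlg0
    have hcle : |c| ≤ l1 f * H := by
      rw [hc, abs_mul, abs_inv, mul_comm, ← div_eq_mul_inv, div_le_iff₀ (abs_pos.mpr hlg0)]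
      calc |coeff df f| ≤ l1 f := abs_coeff_le_l1 _ _
        _ ≤ l1 f * (|coeff dg g| * H) := le_mul_of_one_le_right (l1_nonneg _) hfac
        _ = l1 f * H * |coeff dg g| := by ring
    set f' : Poly n := f - monomial (df - dg) c * g with hf'
    have hred : f' = MonomialOrder.degLex.reduce hunit f := by
      rw [hf', MonomialOrder.reduce, hc]
      congr 3
      rw [Units.val_inv_eq_inv_val, IsUnit.unit_spec]
      rfl
    have hone : (1 : ℝ) ≤ 1 + H ^ 2 := by nlinarith
    have hterm : Cert p e B (monomial (df - dg) c * g + C δ) := by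
      refine Cert.monomial_mul_add_const hp hR1 hR he hgD hP (hcert g hgG hgD) (by omega)
        (by positivity) (hcle.trans ?_) hδ hδ1
      refine mul_le_mul_of_nonneg_right (le_trans ?_ hf) hH.le
      exact le_mul_of_one_le_right (l1_nonneg _) (one_le_pow₀ hone)
    have hf'I : f' ∈ I := I.sub_mem hfI (I.mul_mem_left _ (hG.1 g hgG))
    have hf'D : f'.totalDegree ≤ D := by
      have a1 := totalDegree_sub f (monomial (df - dg) c * g)
      have a2 := totalDegree_mul (monomial (df - dg) c) g
      have a3 : (monomial (df - dg) c).totalDegree ≤ (df - dg).degree :=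
        totalDegree_monomial_le _ _
      rw [← hf'] at a1
      omega
    have hf'1 : l1 f' ≤ l1 f * (1 + H ^ 2) := by
      calc l1 f' ≤ l1 f + l1 (monomial (df - dg) c * g) := l1_sub_le _ _
        _ ≤ l1 f + |c| * l1 g := by gcongr; exact l1_monomial_mul_le _ _ _
        _ ≤ l1 f + l1 f * H * H := by
          have := hl1 g hgG hgD
          have := l1_nonneg g
          have := l1_nonneg f
          gcongr
        _ = l1 f * (1 + H ^ 2) := by ring
    have hf'card : f' = 0 ∨ (mon.filter fun a => MonomialOrder.degLex.toSyn a ≤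
        MonomialOrder.degLex.toSyn (MonomialOrder.degLex.degree f')).card ≤ t := by
      by_cases hdf0 : df = 0
      · left
        have hdg0 : dg = 0 := by rw [hdf0] at hgf; exact le_antisymm hgf zero_le
        have hfC := MonomialOrder.eq_C_of_degree_eq_zero hdf0
        have hgC := MonomialOrder.eq_C_of_degree_eq_zero hdg0
        rw [hf', hdf0, hdg0, tsub_zero]
        have : c * coeff dg g = coeff df f := by rw [hc]; field_simp
        have h0 : (monomial (0 : Fin n →₀ ℕ) c : Poly n) = C c := rfl
        have hg' : g = C (coeff dg g) := hgC
        have hf'' : f = C (coeff df f) := hfC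
        rw [h0, hg', ← C_mul, this, ← hf'', sub_self]
      · right
        have hlt := MonomialOrder.degree_reduce_lt hunit hgf hdf0
        rw [← hred] at hlt
        have hcard' := hcard.resolve_left hf0
        refine Nat.lt_succ_iff.mp (lt_of_lt_of_le (Finset.card_lt_card ?_) hcard')
        rw [Finset.ssubset_iff_of_subset]
        · exact ⟨df, Finset.mem_filter.mpr ⟨(hmon _).mpr hdfD, le_rfl⟩,
            fun h => absurd (Finset.mem_filter.mp h).2 (not_le.mpr hlt)⟩
        · intro a ha
          rw [Finset.mem_filter] at ha ⊢
          exact ⟨ha.1, ha.2.trans hlt.le⟩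
    have hrec := ih f' hf'I hf'D hf'card (by
      refine le_trans ?_ hf
      rw [pow_succ' (1 + H ^ 2), ← mul_assoc]
      gcongr)
    have hsum := hrec.add hterm
    have hid : f + C (((t + 1 : ℕ) : ℝ) * δ) =
        f' + C (t * δ) + (monomial (df - dg) c * g + C δ) := by
      rw [hf', Nat.cast_add, Nat.cast_one, add_mul, one_mul, C_add]
      ring
    rw [hid]
    refine hsum.mono (le_of_eq ?_)
    push_cast
    ring

end Reduction

lemma HasPCDerivation.l1_le {n m k : ℕ} {ρ : Fin k → ℚ} {p : Fin m → Poly n} {f : Poly n}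
    {β deg : ℕ} (hf : HasPCDerivation ρ p f β deg) : l1 f ≤ 2 ^ β := by
  obtain ⟨L, q, -, rfl, hsize, -⟩ := hf
  exact (l1_toReal_le _).trans (pow_le_pow_right₀ one_le_two ((Finset.single_le_sum
    (f := fun i => polyBits (q i)) (fun _ _ => Nat.zero_le _) (Finset.mem_univ _)).trans hsize))

lemma HasPCDerivation.one_le_abs_coeff_mul {n m k : ℕ} {ρ : Fin k → ℚ} {p : Fin m → Poly n}
    {f : Poly n} {β deg : ℕ} (hf : HasPCDerivation ρ p f β deg) {a : Fin n →₀ ℕ}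
    (ha : coeff a f ≠ 0) : 1 ≤ |coeff a f| * 2 ^ β := by
  obtain ⟨L, q, -, rfl, hsize, -⟩ := hf
  rw [coeff_toReal] at ha ⊢
  have hb : polyBits (q (Fin.last L)) ≤ β := (Finset.single_le_sum
    (f := fun i => polyBits (q i)) (fun _ _ => Nat.zero_le _) (Finset.mem_univ _)).trans hsize
  have := one_le_abs_mul_of_den_le (Rat.cast_ne_zero.mp ha)
    ((den_coeff_le _ a).trans (Nat.pow_le_pow_right (by norm_num) hb))
  exact_mod_cast this

/-- An SoS proof of degree at most `2 d` uses squares of polynomials of degree at most `d`. -/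
lemma totalDegree_le_of_sq {n d : ℕ} {s : Poly n} (h : (s ^ 2).totalDegree ≤ 2 * d) :
    s.totalDegree ≤ d := by
  by_cases hs : s = 0
  · simp [hs]
  · rw [pow_two, totalDegree_mul_of_isDomain hs hs] at h
    omega

/-- The exponent bounding the coefficients of the remainder that is divided by the Gröbner
basis. -/
def remainderExponent (k : ℕ) {S : Type*} [CommSemiring S] (N β : S) : S :=
  8 * N + 2 * (2 * N ^ 3 + (k + 1) * β * N ^ 3 + k * β * N) + (4 * N + β + 2 * β * N) + 1

/-- The exponent bounding the coefficients of the sum-of-squares proof. -/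
def sosExponent (k : ℕ) {S : Type*} [CommSemiring S] (N β l : S) : S :=
  4 * N + 1 + ((k + 2) * β + 1) * (2 * N) +
    (2 * (remainderExponent k N β + (2 * β + 1) * N ^ 4 + β) + 4 * β * N + (l + 4 * N) +
      ((k + 12) * β + 4) * β)

lemma map_sosExponent {S T : Type*} [CommSemiring S] [CommSemiring T] (φ : S →+* T) (k : ℕ)
    (N β l : S) : φ (sosExponent k N β l) = sosExponent k (φ N) (φ β) (φ l) := by
  simp only [sosExponent, remainderExponent, map_add, map_mul, map_pow, map_natCast, map_ofNat,
    map_one]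

lemma le_two_pow (N a : ℕ) : (N : ℝ) ^ a ≤ 2 ^ (a * N) := by
  rw [mul_comm, pow_mul]
  exact pow_le_pow_left₀ (Nat.cast_nonneg _) (by exact_mod_cast Nat.lt_two_pow_self.le) a

section Main

variable {n m k c d β : ℕ} {ρ : Fin k → ℚ} {p : Fin m → Poly n} {G : Finset (Poly n)}

/-- If `r ≥ 0` has an SoS proof of degree `2 d`, then `r` is a sum of squares plus a remainder of
bounded coefficients that vanishes on the variety. -/
theorem exists_sum_sq_bounded_remainder (hn : 2 ≤ n) (hρ : ∀ i, ratBits (ρ i) ≤ β)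
    (hp : IsSystemOver ρ p) {r : Poly n} (hr : CoeffBound r (2 ^ β))
    (hsos : HasSoSProof p r (2 * d)) :
    ∃ (t : ℕ) (s : Fin t → Poly n), r.totalDegree ≤ 2 * d ∧ (∀ i, (s i).totalDegree ≤ d) ∧
      (∀ x ∈ variety p, eval x (r - ∑ i, s i ^ 2) = 0) ∧
      l1 (r - ∑ i, s i ^ 2) ≤ 2 ^ remainderExponent k (n ^ d) β := by
  obtain ⟨t, s, h, hid, hds, hdh⟩ := hsos
  set N := n ^ d with hN
  have hdN : d ≤ N := (Nat.lt_pow_self hn).le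
  have hn2 : n + 1 ≤ n ^ 2 := by nlinarith
  have hN2 : (n + 1) ^ d ≤ N ^ 2 := by
    rw [hN, ← pow_mul, mul_comm, pow_mul]; exact Nat.pow_le_pow_left hn2 d
  have hN4 : (n + 1) ^ (2 * d) ≤ N ^ 4 := by
    rw [mul_comm, pow_mul]
    exact (Nat.pow_le_pow_left hN2 2).trans_eq (by ring)
  have hrdeg : r.totalDegree ≤ 2 * d := by
    rw [hid]
    refine (totalDegree_add _ _).trans (max_le ?_ ?_)
    · exact totalDegree_finsetSum_le fun i _ => hds i
    · exact totalDegree_finsetSum_le fun i _ => hdh i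
  obtain ⟨mon, hmonc, hmon⟩ := exists_finset_monomials n (2 * d)
  have hrl1 : l1 r ≤ 2 ^ (4 * N + β) := by
    refine (l1_le_card_mul (support_subset_of_totalDegree_le hmon hrdeg) hr).trans ?_
    rw [pow_add]
    refine mul_le_mul_of_nonneg_right (le_trans ?_ (le_two_pow N 4)) (by positivity)
    exact_mod_cast hmonc.trans hN4
  have hval : ∀ x ∈ variety p, eval x r = ∑ i, eval x (s i) ^ 2 := fun x hx => by
    rw [hid]
    simp only [map_add, map_sum, map_mul, map_pow]
    rw [Finset.sum_eq_zero (s := (Finset.univ : Finset (Fin m))) fun i _ => by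
      rw [show eval x (p i) = 0 from hx i, mul_zero], add_zero]
  set V : ℝ := 2 ^ (4 * N + β + 2 * β * N) with hVdef
  have hV : ∀ x ∈ variety p, ∑ i, eval x (s i) ^ 2 ≤ V := fun x hx => by
    rw [← hval x hx]
    have h1 := abs_eval_le (x := x) (R := 2 ^ β) hrdeg (one_le_pow₀ one_le_two) fun j => by
      obtain ⟨i, hi⟩ := exists_eq_of_mem_variety hp hx j
      rw [hi]
      have h1 := abs_add_one_le_two_pow_ratBits (ρ i)
      have h2 : (2 : ℝ) ^ ratBits (ρ i) ≤ 2 ^ β := pow_le_pow_right₀ one_le_two (hρ i)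
      linarith
    refine (le_abs_self _).trans (h1.trans ?_)
    rw [hVdef, pow_add _ (4 * N + β), ← pow_mul]
    refine mul_le_mul hrl1 (pow_le_pow_right₀ one_le_two ?_) (by positivity) (by positivity)
    calc β * (2 * d) = 2 * β * d := by ring
      _ ≤ 2 * β * N := Nat.mul_le_mul_left _ hdN
  obtain ⟨s', hs'd, hs'e, hs'b⟩ := exists_bounded_representatives hp hρ hN2 s
    (fun i => totalDegree_le_of_sq (hds i)) hV (by positivity)
  refine ⟨t, s', hrdeg, hs'd, fun x hx => ?_, ?_⟩
  · rw [map_sub, hval x hx, map_sum, sub_eq_zero]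
    exact Finset.sum_congr rfl fun i _ => by rw [map_pow, hs'e i x hx]
  · have hb1 : (((N ^ 2 : ℕ) : ℝ) ^ 4) ≤ 2 ^ (8 * N) := by
      rw [Nat.cast_pow, ← pow_mul]; exact le_two_pow N 8
    have hb2 : (((N ^ 2 : ℕ) : ℝ) ^ (N ^ 2)) ≤ 2 ^ (2 * N ^ 3) := by
      rw [Nat.cast_pow, ← pow_mul]
      exact (le_two_pow N _).trans_eq (by ring)
    have hb3 : ((2 : ℝ) ^ ((k + 1) * β * d)) ^ (N ^ 2) ≤ 2 ^ ((k + 1) * β * N ^ 3) := by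
      rw [← pow_mul]
      refine pow_le_pow_right₀ one_le_two ?_
      calc (k + 1) * β * d * N ^ 2 ≤ (k + 1) * β * N * N ^ 2 := by gcongr
        _ = _ := by ring
    have hb4 : (2 : ℝ) ^ (k * β * d) ≤ 2 ^ (k * β * N) :=
      pow_le_pow_right₀ one_le_two (by gcongr)
    have hsum : ∑ i, l1 (s' i) ^ 2 ≤ 2 ^ (8 * N +
        2 * (2 * N ^ 3 + (k + 1) * β * N ^ 3 + k * β * N) + (4 * N + β + 2 * β * N)) := by
      refine hs'b.trans ?_
      calc _ ≤ (2 : ℝ) ^ (8 * N) * (2 ^ (2 * N ^ 3) * 2 ^ ((k + 1) * β * N ^ 3) *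
            2 ^ (k * β * N)) ^ 2 * V := by gcongr
        _ = _ := by rw [hVdef]; simp only [← pow_add, ← pow_mul]; congr 1; ring
    have hr' : l1 r ≤ 2 ^ (8 * N +
        2 * (2 * N ^ 3 + (k + 1) * β * N ^ 3 + k * β * N) + (4 * N + β + 2 * β * N)) :=
      hrl1.trans (pow_le_pow_right₀ one_le_two (by
        have := Nat.zero_le (2 * β * N)
        have := Nat.zero_le (2 * (2 * N ^ 3 + (k + 1) * β * N ^ 3 + k * β * N))
        omega))
    have hs2 : l1 (∑ i, s' i ^ 2) ≤ ∑ i, l1 (s' i) ^ 2 :=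
      (l1_sum_le _ _).trans (Finset.sum_le_sum fun i _ => l1_pow_two_le _)
    have := l1_sub_le r (∑ i, s' i ^ 2)
    unfold remainderExponent
    rw [pow_succ]
    simp only [Nat.cast_id]
    linarith

theorem cert_add_const (hn : 2 ≤ n) (hd : 1 ≤ d) (hρ : ∀ i, ratBits (ρ i) ≤ β)
    (hp : IsSystemOver ρ p) (hG : IsGroebnerBasis (vanishingIdeal ℝ (variety p)) G)
    (hpc : ∀ g ∈ G, g.totalDegree ≤ 2 * d → HasPCDerivation ρ p g β (c * d)) {r : Poly n}
    (hr : CoeffBound r (2 ^ β)) (hsos : HasSoSProof p r (2 * d)) {ε : ℝ} {l : ℕ}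
    (hε : 1 ≤ ε * 2 ^ l) :
    Cert p ((2 * c + 2 * k + 6) * d) (2 ^ sosExponent k (n ^ d) β l) (r + C ε) := by
  obtain ⟨t, s, hrdeg, hsd, hvan, hl1⟩ :=
    exists_sum_sq_bounded_remainder hn hρ hp hr hsos
  set N := n ^ d with hN
  have hdN : d ≤ N := (Nat.lt_pow_self hn).le
  have hn2 : n + 1 ≤ n ^ 2 := by nlinarith
  have hN4 : (n + 1) ^ (2 * d) ≤ N ^ 4 := by
    calc (n + 1) ^ (2 * d) ≤ (n ^ 2) ^ (2 * d) := Nat.pow_le_pow_left hn2 _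
      _ = N ^ 4 := by rw [hN, ← pow_mul, ← pow_mul]; congr 1; ring
  set e := (2 * c + 2 * k + 6) * d with he
  have hdk : k ≤ k * d := Nat.le_mul_of_pos_right k hd
  have he' : e = 2 * (c * d) + 2 * (k * d) + 6 * d := by rw [he]; ring
  have hR1 : (1 : ℝ) ≤ 2 ^ β := one_le_pow₀ one_le_two
  have hR : ∀ i, |(ρ i : ℝ)| + 1 ≤ 2 ^ β := fun i =>
    (abs_add_one_le_two_pow_ratBits _).trans (pow_le_pow_right₀ one_le_two (hρ i))
  obtain ⟨mon, hmonc, hmon⟩ := exists_finset_monomials n (2 * d)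
  set f := r - ∑ i, s i ^ 2 with hf
  have hfI : f ∈ vanishingIdeal ℝ (variety p) := by
    rw [mem_vanishingIdeal_iff]
    exact fun x hx => hvan x hx
  have hfD : f.totalDegree ≤ 2 * d := by
    refine (totalDegree_sub _ _).trans (max_le hrdeg (totalDegree_finsetSum_le fun i _ => ?_))
    exact (totalDegree_pow _ _).trans (Nat.mul_le_mul_left 2 (hsd i))
  set E := remainderExponent k N β with hE
  set δ : ℝ := 1 / 2 ^ (l + 4 * N) with hδ
  have hδ0 : 0 < δ := by positivity
  have hδ1 : δ ≤ 1 := by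
    rw [hδ, div_le_one (by positivity)]; exact one_le_pow₀ one_le_two
  set Γ : ℝ := 2 ^ (E + (2 * β + 1) * N ^ 4) with hΓ
  have hH : (1 : ℝ) + (2 ^ β) ^ 2 ≤ 2 ^ (2 * β + 1) := by
    have h1 : (1 : ℝ) ≤ (2 ^ β) ^ 2 := one_le_pow₀ hR1
    calc (1 : ℝ) + (2 ^ β) ^ 2 ≤ (2 ^ β) ^ 2 + (2 ^ β) ^ 2 := by linarith
      _ = 2 ^ (2 * β + 1) := by ring
  have hred := Cert.add_const_of_mem_ideal (e := e) (P := 2 ^ (((k + 12) * β + 4) * β)) (Γ := Γ)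
    (H := 2 ^ β) hp hR1 hR (by omega) hmon hG (by positivity) (by positivity)
    (fun g hg hgd => (hpc g hg hgd).l1_le)
    (fun g hg hgd a ha => (hpc g hg hgd).one_le_abs_coeff_mul ha)
    (fun g hg hgd => Cert.neg_sq_of_hasPCDerivation hp hρ (hpc g hg hgd) (by omega))
    (by positivity) hδ0 hδ1 (N ^ 4) f hfI hfD
    (Or.inr ((Finset.card_filter_le _ _).trans (hmonc.trans hN4))) (by
      calc l1 f * (1 + (2 ^ β) ^ 2) ^ N ^ 4 ≤ 2 ^ E * (2 ^ (2 * β + 1)) ^ N ^ 4 := by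
            gcongr
        _ = Γ := by rw [hΓ, ← pow_mul, ← pow_add])
  have hNr : ((N ^ 4 : ℕ) : ℝ) ≤ 2 ^ (4 * N) := by
    rw [Nat.cast_pow]; exact le_two_pow N 4
  have hconst : ((N ^ 4 : ℕ) : ℝ) * δ ≤ ε := by
    have h1 : (1 : ℝ) / 2 ^ l ≤ ε := by rwa [div_le_iff₀ (by positivity)]
    refine le_trans ?_ h1
    calc ((N ^ 4 : ℕ) : ℝ) * δ ≤ 2 ^ (4 * N) * δ := by gcongr
      _ = 1 / 2 ^ l := by rw [hδ, pow_add]; field_simp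
  have hsq : Cert p e 0 (∑ i, s i ^ 2) := Cert.sum_sq _ _ fun i _ => by
    have := hsd i; omega
  have hfin := (hsq.add hred).add (Cert.const (p := p) (e := e) (sub_nonneg.mpr hconst))
  have hid : r + C ε = ∑ i, s i ^ 2 + (f + C (((N ^ 4 : ℕ) : ℝ) * δ)) +
      C (ε - ((N ^ 4 : ℕ) : ℝ) * δ) := by
    rw [hf, C_sub]; ring
  rw [hid]
  refine hfin.mono ?_
  rw [zero_add, add_zero]
  have hd2 : 2 * d ≤ 2 * N := by omega
  have hb1 : (((2 : ℝ) ^ β) ^ 2 + (2 ^ β) ^ k) ^ (2 * d) ≤ 2 ^ (((k + 2) * β + 1) * (2 * N)) := by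
    have h1 : ((2 : ℝ) ^ β) ^ 2 ≤ 2 ^ ((k + 2) * β) := by
      rw [← pow_mul]; exact pow_le_pow_right₀ one_le_two (by nlinarith)
    have h2 : ((2 : ℝ) ^ β) ^ k ≤ 2 ^ ((k + 2) * β) := by
      rw [← pow_mul]; exact pow_le_pow_right₀ one_le_two (by nlinarith)
    calc (((2 : ℝ) ^ β) ^ 2 + (2 ^ β) ^ k) ^ (2 * d) ≤ (2 ^ ((k + 2) * β + 1)) ^ (2 * d) := by
          gcongr
          rw [pow_succ (2 : ℝ) ((k + 2) * β)]; linarith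
      _ ≤ (2 ^ ((k + 2) * β + 1)) ^ (2 * N) :=
          pow_le_pow_right₀ (one_le_pow₀ one_le_two) hd2
      _ = _ := by rw [← pow_mul]
  have hb2 : (Γ * 2 ^ β) ^ 2 * (((2 : ℝ) ^ β) ^ 2) ^ (2 * d) / δ * 2 ^ (((k + 12) * β + 4) * β) ≤
      2 ^ (2 * (E + (2 * β + 1) * N ^ 4 + β) + 4 * β * N + (l + 4 * N) +
        ((k + 12) * β + 4) * β) := by
    have h1 : (((2 : ℝ) ^ β) ^ 2) ^ (2 * d) ≤ 2 ^ (4 * β * N) := by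
      rw [← pow_mul, ← pow_mul]
      refine pow_le_pow_right₀ one_le_two ?_
      calc β * (2 * (2 * d)) = 4 * β * d := by ring
        _ ≤ 4 * β * N := Nat.mul_le_mul_left _ hdN
    rw [hδ, div_div_eq_mul_div, div_one, pow_add _ _ (((k + 12) * β + 4) * β),
      pow_add _ _ (l + 4 * N), pow_add _ _ (4 * β * N)]
    gcongr
    rw [hΓ, ← pow_add, ← pow_mul, mul_comm _ 2]
  set a1 := ((k + 2) * β + 1) * (2 * N) with ha1
  set a2 := 2 * (E + (2 * β + 1) * N ^ 4 + β) + 4 * β * N + (l + 4 * N) +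
        ((k + 12) * β + 4) * β with ha2
  have hexp : sosExponent k N β l = 4 * N + 1 + a1 + a2 := by
    simp only [sosExponent, ha1, ha2, hE, Nat.cast_id]
  rw [hexp]
  have c1 : (2 : ℝ) ^ a1 ≤ 2 ^ (a1 + a2) := pow_le_pow_right₀ one_le_two (by omega)
  have c2 : (2 : ℝ) ^ a2 ≤ 2 ^ (a1 + a2) := pow_le_pow_right₀ one_le_two (by omega)
  calc _ ≤ (2 : ℝ) ^ (4 * N) * (2 ^ (a1 + a2) + 2 ^ (a1 + a2)) := by
        refine mul_le_mul hNr (add_le_add (hb1.trans c1) (hb2.trans c2)) (by positivity)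
          (by positivity)
    _ = _ := by ring

theorem cert_neg_one (hd : 1 ≤ d) (hρ : ∀ i, ratBits (ρ i) ≤ β) (hp : IsSystemOver ρ p)
    (hG : IsGroebnerBasis (vanishingIdeal ℝ (variety p)) G)
    (hpc : ∀ g ∈ G, g.totalDegree ≤ 2 * d → HasPCDerivation ρ p g β (c * d))
    (hS : variety p = ∅) :
    Cert p ((2 * c + 2 * k + 6) * d) (2 ^ sosExponent k (n ^ d) β 0) (-1) := by
  obtain ⟨g, hgG, hg0, hg⟩ := hG.2 1 (by
    rw [mem_vanishingIdeal_iff, hS]; simp) one_ne_zero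
  rw [MonomialOrder.degree_one, le_zero_iff] at hg
  have hgdeg : g.totalDegree = 0 := by rw [← degree_degLexDegree, hg]; simp
  have hgC : g = C (coeff 0 g) := by
    have := MonomialOrder.eq_C_of_degree_eq_zero hg
    rwa [MonomialOrder.leadingCoeff, hg] at this
  have ha0 : coeff 0 g ≠ 0 := fun h => hg0 (by rw [hgC, h, C_0])
  have hpcg := hpc g hgG (by omega)
  have h1 := hpcg.one_le_abs_coeff_mul ha0
  set a := coeff 0 g with ha
  have hdk : k ≤ k * d := Nat.le_mul_of_pos_right k hd
  have he' : (2 * c + 2 * k + 6) * d = 2 * (c * d) + 2 * (k * d) + 6 * d := by ring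
  have h2 := Cert.neg_sq_of_hasPCDerivation (e := (2 * c + 2 * k + 6) * d) hp hρ hpcg (by omega)
  have h3 := h2.smul (c := (a ^ 2)⁻¹) (by positivity)
  have hid : C (a ^ 2)⁻¹ * -g ^ 2 = (-1 : Poly n) := by
    rw [hgC, mul_neg, ← C_pow, ← C_mul, inv_mul_cancel₀ (pow_ne_zero 2 ha0), C_1]
  rw [hid] at h3
  refine h3.mono ?_
  have h4 : (a ^ 2)⁻¹ ≤ 2 ^ (2 * β) := by
    rw [inv_le_iff_one_le_mul₀ (by positivity)]
    calc (1 : ℝ) ≤ (|a| * 2 ^ β) ^ 2 := one_le_pow₀ h1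
      _ = 2 ^ (2 * β) * a ^ 2 := by rw [mul_pow, sq_abs, ← pow_mul, mul_comm, mul_comm β]
  calc (a ^ 2)⁻¹ * 2 ^ (((k + 12) * β + 4) * β) ≤
        2 ^ (2 * β) * 2 ^ (((k + 12) * β + 4) * β) := by gcongr
    _ = 2 ^ (2 * β + ((k + 12) * β + 4) * β) := by rw [← pow_add]
    _ ≤ _ := by
      refine pow_le_pow_right₀ one_le_two ?_
      simp only [sosExponent, Nat.cast_id]
      omega

end Main

lemma eval_aeval_X_zero (b : Polynomial ℕ) (v : Fin 2 → ℕ) :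
    eval v (Polynomial.aeval (X 0 : MvPolynomial (Fin 2) ℕ) b) = b.eval (v 0) := by
  rw [Polynomial.aeval_def, Polynomial.hom_eval₂, eval_X,
    Subsingleton.elim ((eval v).comp (algebraMap ℕ (MvPolynomial (Fin 2) ℕ))) (RingHom.id ℕ)]
  rfl

end PCCriterion

end

theorem mainTheorem1 (k c : ℕ) :
    ∃ A : ℕ, ∀ b : Polynomial ℕ, ∃ Q : MvPolynomial (Fin 2) ℕ,
      ∀ (n d m : ℕ), 2 ≤ n → 1 ≤ d →
      ∀ (ρ : Fin k → ℚ) (p : Fin m → PCCriterion.Poly n) (G : Finset (PCCriterion.Poly n)),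
        (∀ i, PCCriterion.ratBits (ρ i) ≤ b.eval (n ^ d)) →
        PCCriterion.IsSystemOver ρ p →
        PCCriterion.IsGroebnerBasis
          (MvPolynomial.vanishingIdeal ℝ (PCCriterion.variety p)) G →
        (∀ g ∈ G, g.totalDegree ≤ 2 * d →
          PCCriterion.CoeffBound g (2 ^ b.eval (n ^ d))) →
        (∀ g ∈ G, g.totalDegree ≤ 2 * d →
          PCCriterion.HasPCDerivation ρ p g (b.eval (n ^ d)) (c * d)) →
        (∀ r : PCCriterion.Poly n,
          PCCriterion.CoeffBound r (2 ^ b.eval (n ^ d)) →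
          PCCriterion.HasSoSProof p r (2 * d) →
          ∀ ε : ℝ, 0 < ε →
            PCCriterion.HasBoundedSoSProof p (r + MvPolynomial.C ε) (A * d)
              (2 ^ MvPolynomial.eval ![n ^ d, ⌈Real.logb 2 (1 / ε)⌉₊] Q)) ∧
        (PCCriterion.variety p = ∅ →
          PCCriterion.HasBoundedSoSProof p (-1) (A * d)
            (2 ^ MvPolynomial.eval ![n ^ d, 0] Q)) := by
  refine ⟨2 * c + 2 * k + 6, fun b => ⟨PCCriterion.sosExponent k (MvPolynomial.X 0)
    (Polynomial.aeval (MvPolynomial.X 0) b) (MvPolynomial.X 1), ?_⟩⟩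
  intro n d m hn hd ρ p G hρ hp hG _ hpc
  have hQ : ∀ l : ℕ, MvPolynomial.eval ![n ^ d, l] (PCCriterion.sosExponent k (MvPolynomial.X 0)
      (Polynomial.aeval (MvPolynomial.X 0) b) (MvPolynomial.X 1)) =
      PCCriterion.sosExponent k (n ^ d) (b.eval (n ^ d)) l := fun l => by
    rw [PCCriterion.map_sosExponent, PCCriterion.eval_aeval_X_zero]
    simp
  refine ⟨fun r hr hsos ε hε => ?_, fun hS => ?_⟩
  · rw [hQ]
    refine (PCCriterion.cert_add_const hn hd hρ hp hG hpc hr hsos ?_).hasBoundedSoSProof le_rfl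
      (by positivity)
    have h1 : 1 / ε ≤ 2 ^ ⌈Real.logb 2 (1 / ε)⌉₊ := by
      rw [← Real.rpow_natCast, ← Real.logb_le_iff_le_rpow one_lt_two (by positivity)]
      exact Nat.le_ceil _
    rwa [div_le_iff₀ hε, mul_comm] at h1
  · rw [hQ]
    exact (PCCriterion.cert_neg_one hd hρ hp hG hpc hS).hasBoundedSoSProof le_rfl (by positivity)
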